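/- **Proposition (lower bounds for APGM with $\eta_2$).** Let $d\ge 1$, let $\Theta$ be a compact connected $d$-dimensional Riemannian manifold without boundary, and let $\tau$ be the probability measure on $\Theta$ proportional to the volume measure. *Objectives.* Let $\mathcal M(\Theta)$ be the space of finite signed Borel measures on $\Theta$. We consider objectives $\bar F=\bar G+\bar H:\mathcal M(\Theta)\to\mathbb R\cup\{+\infty\}$ with $\bar G(\mu)=R\big(\int\Phi\,d\mu\big)$, where $\Phi:\Theta\to\mathcal F$ is continuous with values in a real Hilbert space $\mathcal F$, $R:\mathcal F\to\mathbb R$ is convex and differentiable with Lipschitz gradient, and $\bar H$ is a finite sum of functions from the list $\iota_{\mathcal P(\Theta)}$, $\iota_{\mathcal M_+(\Theta)}$, $\lambda\|\cdot\|$, $\iota_{\{\mu:\lambda\|\mu\|\le 1\}}$, with $\lambda\ge 0$ (here $\iota_C$ is $0$ on $C$ and $+\infty$ elsewhere, and $\|\cdot\|$ is the total variation norm). Put $\bar G'[\mu](\theta)=\langle\nabla R(\int\Phi\,d\mu),\Phi(\theta)\rangle$, and for $f\in L^1(\tau)$ put $F(f)=\bar F(f\tau)$, $G(f)=\bar G(f\tau)$,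 $H(f)=\bar H(f\tau)$, $G'[f]=\bar G'[f\tau]$. Write $\inf F$ for the infimum of $F$ over $L^1(\tau)$. *Settings.* In each setting there is $\mu^*\in\mathcal M(\Theta)$ with $\bar F(\mu^*)=\inf F$, and in addition: (I) $\Phi$ is Lipschitz ($q=1$); (II) $\Phi$ is $C^1$ and $\nabla_\theta\Phi$ is Lipschitz ($q=2$); (I*) $\Phi$ is Lipschitz and $\bar G'[\mu^*]=0$ for such a $\mu^*$ ($q=2$); (II*) $\Phi$ is $C^1$, $\nabla_\theta\Phi$ is Lipschitz and $\bar G'[\mu^*]=0$ for such a $\mu^*$ ($q=4$). *Algorithm.* APGM with $\eta_2(t)=t^2/2$, step-size $s>0$ and initialization $f_0\equiv 1$ (where it is required that $H(f_0)<+\infty$) sets $h_0=f_0$, $\gamma_0=1$ and, for $k\ge 0$, $$g_k=(1-\gamma_k)f_k+\gamma_kh_k,$$ $$h_{k+1}\in\arg\min_{f\in L^1(\tau)}\Big\{G(g_k)+\int G'[g_k](f-g_k)\,d\tau+H(f)+\frac{\gamma_k}{s}\,D(f,h_k)\Big\},\qquad D(f,h)=\frac12\int (f-h)^2\,d\tau\in[0,+\infty],$$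 $$f_{k+1}=(1-\gamma_k)f_k+\gamma_kh_{k+1},\qquad \gamma_{k+1}=\tfrac12\Big(\sqrt{\gamma_k^4+4\gamma_k^2}-\gamma_k^2\Big).$$ *Claim.* For each of the settings (I), (II), (I*), (II*), with $q$ the corresponding exponent, there exists an objective belonging to this setting such that for every step-size $s>0$ iterates of APGM as above exist, and there is a constant $c>0$ (independent of $k$) such that all such iterates satisfy $$F(f_k)-\inf F\ \ge\ c\,k^{-\frac{2q}{d+q}}\qquad\text{for all }k\ge 1.$$ -/

import Mathlib

open MeasureTheory Topology Manifold Set Bundle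
open scoped ENNReal NNReal ContDiff RealInnerProductSpace

noncomputable section

/-- The admissible summands of the regularizer. With `lam ≥ 0` the regularization parameter, they
stand for: the convex indicator of the probability measures, the convex indicator of the
nonnegative measures, `lam` times the total variation norm, and the convex indicator of
`{μ | lam * ‖μ‖ ≤ 1}`. -/
inductive RegTerm
  | prob
  | nonneg
  | tv
  | tvBall

open scoped Classical in
/-- Value in `[0, ∞]` of an admissible summand at a finite signed measure. -/
def RegTerm.val {Θ : Type*} [MeasurableSpace Θ] (lam : ℝ≥0) (μ : SignedMeasure Θ) :
    RegTerm → ℝ≥0∞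
  | .prob => if 0 ≤ μ ∧ μ univ = 1 then 0 else ⊤
  | .nonneg => if 0 ≤ μ then 0 else ⊤
  | .tv => lam * μ.totalVariation univ
  | .tvBall => if lam * μ.totalVariation univ ≤ 1 then 0 else ⊤

/-- The data of an objective function `Fbar(μ) = R(∫ Φ dμ) + Hbar(μ)` on the space of finite
signed measures on `Θ`: a continuous `Φ` with values in a real Hilbert space `E`, a convex
differentiable `R : E → ℝ` with Lipschitz gradient, and a finite sum `Hbar` of admissible
regularizers. -/
structure Objective (Θ : Type*) [TopologicalSpace Θ] where
  E : Type
  [normed : NormedAddCommGroup E]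
  [inner : InnerProductSpace ℝ E]
  [complete : CompleteSpace E]
  Φ : C(Θ, E)
  R : E → ℝ
  R_convex : ConvexOn ℝ univ R
  R_differentiable : Differentiable ℝ R
  R_smooth : ∃ L : ℝ≥0, LipschitzWith L (gradient R)
  lam : ℝ≥0
  reg : List RegTerm

attribute [instance] Objective.normed Objective.inner Objective.complete

namespace Objective

variable {Θ : Type*} [TopologicalSpace Θ] [MeasurableSpace Θ] (J : Objective Θ)

/-- The smooth part `Gbar(μ) = R(∫ Φ dμ)`. -/
def Gbar (μ : SignedMeasure Θ) : ℝ := J.R (∫ᵛ θ, J.Φ θ ∂<•μ)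

/-- The differential of `Gbar` at `μ`, represented by the function
`θ ↦ ⟪∇R(∫ Φ dμ), Φ(θ)⟫` on `Θ`. -/
def Gbar' (μ : SignedMeasure Θ) (θ : Θ) : ℝ :=
  ⟪gradient J.R (∫ᵛ θ', J.Φ θ' ∂<•μ), J.Φ θ⟫

/-- The regularizer. -/
def Hbar (μ : SignedMeasure Θ) : ℝ≥0∞ := (J.reg.map (RegTerm.val J.lam μ)).sum

/-- The objective on measures, with values in `ℝ ∪ {+∞}`. -/
def Fbar (μ : SignedMeasure Θ) : EReal := (J.Gbar μ : EReal) + (J.Hbar μ : EReal)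

variable (τ : Measure Θ)

/-- `G(f) = Gbar(f τ)` for `f ∈ L¹(τ)`. -/
def G (f : Lp ℝ 1 τ) : ℝ := J.Gbar (τ.withDensityᵥ f)

/-- `G'[f] = Gbar'[f τ]` for `f ∈ L¹(τ)`. -/
def G' (f : Lp ℝ 1 τ) : Θ → ℝ := J.Gbar' (τ.withDensityᵥ f)

/-- `H(f) = Hbar(f τ)` for `f ∈ L¹(τ)`. -/
def H (f : Lp ℝ 1 τ) : ℝ≥0∞ := J.Hbar (τ.withDensityᵥ f)

/-- `F(f) = Fbar(f τ)` for `f ∈ L¹(τ)`. -/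
def F (f : Lp ℝ 1 τ) : EReal := J.Fbar (τ.withDensityᵥ f)

/-- `inf F`, the infimum of the objective over `L¹(τ)`. -/
def infF : EReal := ⨅ f : Lp ℝ 1 τ, J.F τ f

end Objective

/-- The power function `η_p(s) = |s|^p / (p (p - 1))`. -/
def powerEntropy (p : ℝ) (s : ℝ) : ℝ := |s| ^ p / (p * (p - 1))

/-- The pointwise Bregman divergence `D_η(a, b) = η(a) - η(b) - η'(b) (a - b)`. -/
def bregman (η : ℝ → ℝ) (a b : ℝ) : ℝ := η a - η b - deriv η b * (a - b)

/-- The integrated Bregman divergence `∫ D_η(f, g) dτ ∈ [0, ∞]` (for convex `η`). -/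
def bregmanInt {Θ : Type*} [MeasurableSpace Θ] (τ : Measure Θ) (η : ℝ → ℝ)
    (f g : Lp ℝ 1 τ) : ℝ≥0∞ :=
  ∫⁻ θ, ENNReal.ofReal (bregman η (f θ) (g θ)) ∂τ

/-- The function of `u` minimized at a step of APGM: the linearization of `G` at `g`, plus `H(u)`,
plus `γ / s` times the divergence from `u` to `h`. -/
def apgmModel {Θ : Type*} [TopologicalSpace Θ] [MeasurableSpace Θ] (J : Objective Θ)
    (τ : Measure Θ) (η : ℝ → ℝ) (s γ : ℝ) (g h u : Lp ℝ 1 τ) : EReal :=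
  ((J.G τ g + ∫ θ, J.G' τ g θ * (u θ - g θ) ∂τ : ℝ) : EReal) + (J.H τ u : EReal)
    + ((ENNReal.ofReal (γ / s) * bregmanInt τ η u h : ℝ≥0∞) : EReal)

/-- `(f_k), (g_k), (h_k), (γ_k)` is a run of the accelerated (Bregman) proximal gradient method
with distance-generating function `η` and step-size `s`, started at `f_0 = h_0 = f0 ∈ dom H`. -/
structure IsAPGM {Θ : Type*} [TopologicalSpace Θ] [MeasurableSpace Θ] (J : Objective Θ)
    (τ : Measure Θ) (η : ℝ → ℝ) (s : ℝ) (f0 : Lp ℝ 1 τ)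
    (f g h : ℕ → Lp ℝ 1 τ) (γ : ℕ → ℝ) : Prop where
  dom : J.H τ f0 ≠ ⊤
  f_zero : f 0 = f0
  h_zero : h 0 = f0
  γ_zero : γ 0 = 1
  g_eq : ∀ k, g k = (1 - γ k) • f k + γ k • h k
  h_succ : ∀ k, IsMinOn (apgmModel J τ η s (γ k) (g k) (h k)) univ (h (k + 1))
  f_succ : ∀ k, f (k + 1) = (1 - γ k) • f k + γ k • h (k + 1)
  γ_succ : ∀ k, γ (k + 1) = (√(γ k ^ 4 + 4 * γ k ^ 2) - γ k ^ 2) / 2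

/-- A `C¹` map `Φ` on a compact manifold whose differential is Lipschitz. This is expressed in
charts: around each point, the derivative of `Φ` read in the preferred chart is Lipschitz near the
image of the point. On a compact smooth Riemannian manifold this amounts to `∇Φ` being Lipschitz
for the Riemannian distance. -/
def HasLipschitzGradient {d : ℕ} {Θ : Type*} [TopologicalSpace Θ]
    [ChartedSpace (EuclideanSpace ℝ (Fin d)) Θ] {E : Type*} [NormedAddCommGroup E]
    [NormedSpace ℝ E] (Φ : Θ → E) : Prop :=
  ContMDiff (𝓡 d) 𝓘(ℝ, E) 1 Φ ∧
    ∀ x : Θ, ∃ K : ℝ≥0, ∃ U ∈ 𝓝 (extChartAt (𝓡 d) x x),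
      LipschitzOnWith K (fderiv ℝ (Φ ∘ (extChartAt (𝓡 d) x).symm)) U

/-- The four settings. -/
inductive Setting
  | I
  | II
  | IStar
  | IIStar

/-- The exponent attached to a setting. -/
def Setting.q : Setting → ℕ
  | .I => 1
  | .II => 2
  | .IStar => 2
  | .IIStar => 4

/-- `J` belongs to the given setting: there is a measure `μ` with `Fbar(μ) = inf F`, such that
`Gbar'[μ] = 0` for the starred settings, and `Φ` (settings I, I*), respectively `∇Φ`
(settings II, II*), is Lipschitz. -/
def Setting.Holds {d : ℕ} {Θ : Type*} [MetricSpace Θ] [MeasurableSpace Θ]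
    [ChartedSpace (EuclideanSpace ℝ (Fin d)) Θ] (τ : Measure Θ) (J : Objective Θ) :
    Setting → Prop
  | .I => (∃ K : ℝ≥0, LipschitzWith K J.Φ) ∧ ∃ μ : SignedMeasure Θ, J.Fbar μ = J.infF τ
  | .II => HasLipschitzGradient (d := d) J.Φ ∧ ∃ μ : SignedMeasure Θ, J.Fbar μ = J.infF τ
  | .IStar => (∃ K : ℝ≥0, LipschitzWith K J.Φ) ∧
      ∃ μ : SignedMeasure Θ, J.Fbar μ = J.infF τ ∧ ∀ θ, J.Gbar' μ θ = 0
  | .IIStar => HasLipschitzGradient (d := d) J.Φ ∧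
      ∃ μ : SignedMeasure Θ, J.Fbar μ = J.infF τ ∧ ∀ θ, J.Gbar' μ θ = 0

end

/-! The objective is `R (∫ Φ dμ)` restricted to probability measures, with `Φ ≥ 0` real-valued,
vanishing only at one point `x` and comparable to `dist θ x ^ m`, where `m = 1` (the distance) or `m
= 2` (a smooth function). The loss is `R y = y` in settings I, II, giving `q = m`, and `R y = y ^ 2
/ 2` in I*, II*, giving `q = 2 m`. A Dirac mass at `x` is a minimizer, and in the quadratic case the
differential vanishes there.

For `η_2` a step is an L² projection onto probability densities after moving along a multiple of
`-Φ`. Started from the constant density, every `h_k` is therefore a truncated affine profile `(c - a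
Φ)₊` with `a = A_k` the accumulated step-size. Supports shrink as `a` grows, so mass truncated once
never returns, and a projection from a profile is again a profile (`level_mul_le`, `optimality`,
`isMinOn_apgmModel_iff`). The whole run reduces to a recursion for the reals `A_k` and `y_k = ∫ Φ
f_k` (`isScalarAPGM_of_isAPGM`).

Charts are locally bi-Lipschitz, so sublevel sets `{Φ ≤ t}` have mass of order `t ^ (d / m)`.
Normalizing the profile then gives `∫ Φ h ≍ (1 + a) ^ (-β)` with `β = m / (d + m)`
(`exists_profileValue_bounds`). A profile decays no faster than its accumulated step allows, and
averaging preserves this bound, so only an upper bound on `A_k` is missing.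

For the linear loss, `A_k = O(k ^ 2)` because `1 / γ_k ≤ k + 1`. For the quadratic loss the driving
force `y_k` itself decays; an energy estimate for the weighted recursion yields the slower growth
`A_k = O(k ^ (2 / (1 + β)))` (`exists_growth_bound`). Inserting these into `(1 + A_k) ^ (-β)` gives
the two rates. -/

/-! ### Real sequences -/

/-- Tangent inequality for a concave power. -/
theorem rpow_le_rpow_add_mul {p a b : ℝ} (hp0 : 0 ≤ p) (hp1 : p ≤ 1) (ha : 0 < a) (hb : 0 ≤ b) :
    b ^ p ≤ a ^ p + p * a ^ (p - 1) * (b - a) := by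
  have h := rpow_one_add_le_one_add_mul_self (s := b / a - 1) (by
    have := div_nonneg hb ha.le
    linarith) hp0 hp1
  rw [add_sub_cancel, Real.div_rpow hb ha.le, div_le_iff₀ (Real.rpow_pos_of_pos ha p)] at h
  refine h.trans (le_of_eq ?_)
  rw [Real.rpow_sub_one ha.ne']
  field_simp

/-- Comparison of a left Riemann rectangle of `x ^ (-β)` with the increment of its primitive. -/
theorem rpow_neg_mul_sub_le {β a b L : ℝ} (hβ0 : 0 < β) (hβ1 : β < 1) (ha : 0 < a) (hab : a ≤ b)
    (hL : b ≤ L * a) :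
    a ^ (-β) * (b - a) ≤ L ^ β / (1 - β) * (b ^ (1 - β) - a ^ (1 - β)) := by
  have hb : 0 < b := ha.trans_le hab
  have hL0 : 0 < L := pos_of_mul_pos_left (hb.trans_le hL) ha.le
  have h := rpow_le_rpow_add_mul (p := 1 - β) (by linarith) (by linarith) hb ha.le
  have h1 : (1 - β) * (b ^ (-β) * (b - a)) ≤ b ^ (1 - β) - a ^ (1 - β) := by
    rw [show 1 - β - 1 = -β by ring] at h
    linarith
  -- Concavity at the right endpoint controls `b ^ (-β)`; the bounded ratio `b / a ≤ L` pays for the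
  -- rectangle having its height at the left endpoint.
  have h2 : a ^ (-β) ≤ L ^ β * b ^ (-β) := by
    rw [Real.rpow_neg ha.le, Real.rpow_neg hb.le, ← div_eq_mul_inv, le_div_iff₀ (by positivity),
      inv_mul_le_iff₀ (by positivity), mul_comm, ← Real.mul_rpow hL0.le ha.le]
    exact Real.rpow_le_rpow hb.le hL hβ0.le
  calc a ^ (-β) * (b - a) ≤ L ^ β * b ^ (-β) * (b - a) := by
        have : 0 ≤ b - a := by linarith
        gcongr
    _ = L ^ β / (1 - β) * ((1 - β) * (b ^ (-β) * (b - a))) := by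
        have : 1 - β ≠ 0 := by linarith
        field_simp
    _ ≤ _ := by
        have : 0 < 1 - β := by linarith
        gcongr

/-- Growth bound for the accumulated step-sizes of the accelerated dynamics whose driving force
decays like a negative power of the accumulated step-size. -/
theorem exists_growth_bound {β s K : ℝ} (hβ0 : 0 < β) (hβ1 : β < 1) (hs : 0 < s) (hK : 0 < K) :
    ∃ C : ℝ, 0 < C ∧ ∀ T z Y A : ℕ → ℝ, (∀ k, 1 ≤ T k) → Monotone T → Y 0 = 0 →
      (∀ k, Y (k + 1) = Y k + T k * z (k + 1)) →
      (∀ k, T k * (A (k + 1) - A k) = s * (Y k + T k * z k)) → A 0 = 0 →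
      (∀ k, 0 ≤ z k) → (∀ k, z k ≤ K * (1 + A k) ^ (-β)) →
      ∀ k : ℕ, (1 + A k) ^ ((1 + β) / 2) ≤ C * (k + 1) := by
  set L : ℝ := 2 + 2 * s * K with hL
  set C1 : ℝ := 2 * K / s * (L ^ β / (1 - β)) with hC1
  set C2 : ℝ := s * (√C1 * L ^ ((1 - β) / 2) + K) with hC2
  have hL0 : 0 < L := by positivity
  have h1β : 0 < 1 - β := by linarith
  have hC10 : 0 < C1 := by positivity
  have hC20 : 0 < C2 := by positivity
  refine ⟨1 + C2, by positivity, ?_⟩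
  intro T z Y A hT1 hT hY0 hY hA hA0 hz hzK
  have hT0 : ∀ k, 0 < T k := fun k => one_pos.trans_le (hT1 k)
  have hYnn : ∀ k, 0 ≤ Y k := by
    intro k
    induction k with
    | zero => rw [hY0]
    | succ k ih => rw [hY]; have := hT0 k; have := hz (k + 1); positivity
  have hD : ∀ k, A (k + 1) - A k = s * (Y k / T k + z k) := by
    intro k
    have h := hA k
    have := (hT0 k).ne'
    field_simp
    linarith
  have hDnn : ∀ k, 0 ≤ A (k + 1) - A k := by
    intro k
    rw [hD]
    have := hT0 k; have := hz k; have := hYnn k; positivity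
  have hAnn : ∀ k, 0 ≤ A k := by
    intro k
    induction k with
    | zero => rw [hA0]
    | succ k ih => linarith [hDnn k]
  have hzK' : ∀ k, z k ≤ K := by
    intro k
    refine (hzK k).trans ?_
    have : (1 + A k) ^ (-β) ≤ 1 :=
      Real.rpow_le_one_of_one_le_of_nonpos (by linarith [hAnn k]) (by linarith)
    nlinarith
  -- Increments of `A` grow at most additively. Hence `1 + A` grows by a bounded factor per step,
  -- which is where `L` comes from and what permits comparing Riemann sums with integrals.
  have hDD : ∀ k, A (k + 2) - A (k + 1) ≤ A (k + 1) - A k + 2 * s * K := by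
    intro k
    rw [hD k, hD (k + 1)]
    have h1 : Y (k + 1) / T (k + 1) ≤ Y (k + 1) / T k :=
      div_le_div_of_nonneg_left (hYnn _) (hT0 k) (hT k.le_succ)
    have h2 : Y (k + 1) / T k = Y k / T k + z (k + 1) := by
      rw [hY]
      have := (hT0 k).ne'
      field_simp
    have h3 := hzK' (k + 1)
    have h4 := hz k
    have : Y (k + 1) / T (k + 1) + z (k + 1) ≤ Y k / T k + z k + 2 * K := by linarith
    nlinarith
  have hratio : ∀ k, 1 + A (k + 1) ≤ L * (1 + A k) := by
    intro k
    cases k with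
    | zero =>
      have h := hD 0
      rw [hY0, hA0] at h
      have := mul_le_mul_of_nonneg_left (hzK' 0) hs.le
      rw [hA0, hL]
      have : 0 < s * K := by positivity
      simp only [zero_add, zero_div, sub_zero] at h ⊢
      linarith
    | succ k =>
      have h1 := hDD k
      have h2 := hAnn k
      have h3 : 0 ≤ s * K * A (k + 1) := by have := hAnn (k + 1); positivity
      rw [hL]
      have : k + 1 + 1 = k + 2 := rfl
      rw [this]
      linarith
  -- Energy estimate: the increment of `Y ^ 2` is at most `2 Y T z`, where `Y` is bounded by `T ΔA /
  -- s` and `z` by `K (1 + A) ^ (-β)`. The result is a Riemann rectangle, so the sum telescopes into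
  -- `(1 + A) ^ (1 - β)`.
  have hYsq : ∀ k, Y k ^ 2 ≤ C1 * T k ^ 2 * (1 + A (k + 1)) ^ (1 - β) := by
    intro k
    induction k with
    | zero =>
      rw [hY0, zero_pow two_ne_zero]
      have := hAnn 1
      have := hT0 0
      positivity
    | succ k ih =>
      have hB : 0 < 1 + A (k + 1) := by linarith [hAnn (k + 1)]
      have e1 : Y (k + 1) ^ 2 ≤ Y k ^ 2 + 2 * Y (k + 1) * (T k * z (k + 1)) := by
        have h := hY k
        have : Y k = Y (k + 1) - T k * z (k + 1) := by linarith
        rw [this]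
        nlinarith [sq_nonneg (T k * z (k + 1))]
      have e2 : Y (k + 1) ≤ T (k + 1) * (A (k + 2) - A (k + 1)) / s := by
        rw [le_div_iff₀ hs, hA (k + 1)]
        have : 0 ≤ s * (T (k + 1) * z (k + 1)) := by
          have := hT0 (k + 1); have := hz (k + 1); positivity
        linarith
      have e3 : Y (k + 1) * (T k * z (k + 1)) ≤
          T (k + 1) * (A (k + 2) - A (k + 1)) / s *
            (T (k + 1) * (K * (1 + A (k + 1)) ^ (-β))) := by
        have := hT k.le_succ
        have := hDnn (k + 1)
        have := hT0 (k + 1)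
        have := hT0 k
        have := hz (k + 1)
        gcongr
        exact hzK (k + 1)
      have e4 := rpow_neg_mul_sub_le hβ0 hβ1 hB (b := 1 + A (k + 2))
        (by linarith [hDnn (k + 1)]) (hratio (k + 1))
      have e5 : C1 * T k ^ 2 * (1 + A (k + 1)) ^ (1 - β) ≤
          C1 * T (k + 1) ^ 2 * (1 + A (k + 1)) ^ (1 - β) := by
        have := hT k.le_succ
        have := hT0 k
        gcongr
      have e6 : T (k + 1) * (A (k + 2) - A (k + 1)) / s *
            (T (k + 1) * (K * (1 + A (k + 1)) ^ (-β))) =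
          K / s * T (k + 1) ^ 2 *
            ((1 + A (k + 1)) ^ (-β) * (1 + A (k + 2) - (1 + A (k + 1)))) := by
        field_simp
        ring
      have e7 : K / s * T (k + 1) ^ 2 *
            ((1 + A (k + 1)) ^ (-β) * (1 + A (k + 2) - (1 + A (k + 1)))) ≤
          K / s * T (k + 1) ^ 2 * (L ^ β / (1 - β) *
            ((1 + A (k + 2)) ^ (1 - β) - (1 + A (k + 1)) ^ (1 - β))) := by
        have := hT0 (k + 1)
        gcongr
      have e8 : 2 * (K / s * T (k + 1) ^ 2 * (L ^ β / (1 - β) *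
            ((1 + A (k + 2)) ^ (1 - β) - (1 + A (k + 1)) ^ (1 - β)))) =
          C1 * T (k + 1) ^ 2 * ((1 + A (k + 2)) ^ (1 - β) - (1 + A (k + 1)) ^ (1 - β)) := by
        rw [hC1]
        ring
      have : k + 1 + 1 = k + 2 := rfl
      rw [this]
      linarith
  have hDbound : ∀ k, A (k + 1) - A k ≤ C2 * (1 + A k) ^ ((1 - β) / 2) := by
    intro k
    have hB : 1 ≤ 1 + A k := by linarith [hAnn k]
    have hB' : 0 ≤ 1 + A (k + 1) := by linarith [hAnn (k + 1)]
    have e1 : Y k / T k ≤ √C1 * (1 + A (k + 1)) ^ ((1 - β) / 2) := by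
      rw [div_le_iff₀ (hT0 k)]
      refine (pow_le_pow_iff_left₀ (hYnn k) (by have := hT0 k; positivity) two_ne_zero).1 ?_
      have e : ((1 + A (k + 1)) ^ ((1 - β) / 2)) ^ 2 = (1 + A (k + 1)) ^ (1 - β) := by
        rw [← Real.rpow_mul_natCast hB']
        congr 1
        push_cast
        ring
      rw [mul_pow, mul_pow, Real.sq_sqrt hC10.le, e]
      linarith [hYsq k]
    have e2 : (1 + A (k + 1)) ^ ((1 - β) / 2) ≤ L ^ ((1 - β) / 2) * (1 + A k) ^ ((1 - β) / 2) := by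
      rw [← Real.mul_rpow hL0.le (by linarith)]
      exact Real.rpow_le_rpow hB' (hratio k) (by linarith)
    have e3 : z k ≤ K * (1 + A k) ^ ((1 - β) / 2) := by
      refine (hzK' k).trans ?_
      have := Real.one_le_rpow hB (show 0 ≤ (1 - β) / 2 by linarith)
      nlinarith
    have e4 := mul_le_mul_of_nonneg_left e2 (Real.sqrt_nonneg C1)
    rw [hD k, hC2, mul_assoc]
    refine mul_le_mul_of_nonneg_left ?_ hs.le
    linarith
  intro k
  induction k with
  | zero =>
    rw [hA0]
    simp [hC20.le]
  | succ k ih =>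
    have hB : 0 < 1 + A k := by linarith [hAnn k]
    -- The power `(1 + β) / 2` is chosen so that its derivative cancels the factor `(1 + A) ^ ((1 -
    -- β) / 2)` in `hDbound`; each step then adds at most `C2`.
    have h := rpow_le_rpow_add_mul (p := (1 + β) / 2) (by linarith) (by linarith) hB
      (b := 1 + A (k + 1)) (by linarith [hAnn (k + 1)])
    have h1 : (1 + β) / 2 * (1 + A k) ^ ((1 + β) / 2 - 1) * (1 + A (k + 1) - (1 + A k)) ≤ C2 := by
      calc _ ≤ 1 * (1 + A k) ^ ((1 + β) / 2 - 1) * (C2 * (1 + A k) ^ ((1 - β) / 2)) := by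
            have := hDnn k
            gcongr
            · linarith
            · linarith
            · linarith [hDbound k]
        _ = C2 * ((1 + A k) ^ ((1 + β) / 2 - 1) * (1 + A k) ^ ((1 - β) / 2)) := by ring
        _ = C2 := by
            rw [← Real.rpow_add hB]
            rw [show (1 + β) / 2 - 1 + (1 - β) / 2 = 0 by ring, Real.rpow_zero, mul_one]
    push_cast
    linarith

/-- The recursion defining the extrapolation parameters, as a quadratic equation. -/
theorem sqrt_recursion {x : ℝ} (hx : 0 < x) (hx1 : x ≤ 1) :
    let y := (√(x ^ 4 + 4 * x ^ 2) - x ^ 2) / 2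
    0 < y ∧ y ≤ 1 ∧ y ≤ x ∧ y ^ 2 = x ^ 2 * (1 - y) ∧ y⁻¹ ≤ x⁻¹ + 1 := by
  intro y
  have hsq : √(x ^ 4 + 4 * x ^ 2) ^ 2 = x ^ 4 + 4 * x ^ 2 := Real.sq_sqrt (by positivity)
  have hlt : x ^ 2 < √(x ^ 4 + 4 * x ^ 2) := by
    apply Real.lt_sqrt_of_sq_lt
    have : 0 < x ^ 2 := by positivity
    nlinarith
  have hy0 : 0 < y := by
    simp only [y]
    linarith
  have heq : y ^ 2 = x ^ 2 * (1 - y) := by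
    simp only [y]
    nlinarith
  have hyx : y ≤ x := by
    refine (pow_le_pow_iff_left₀ hy0.le hx.le two_ne_zero).1 ?_
    nlinarith [mul_pos (pow_pos hx 2) hy0]
  refine ⟨hy0, hyx.trans hx1, hyx, heq, ?_⟩
  have h : (y⁻¹ - 1) * y⁻¹ = (x⁻¹) ^ 2 := by
    field_simp
    linarith
  have h1 : 0 < x⁻¹ := inv_pos.2 hx
  -- By `h`, `y⁻¹ > x⁻¹ + 1` would force `x⁻¹ ^ 2 > (x⁻¹ + 1) * x⁻¹`.
  by_contra! hc
  nlinarith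

/-- The extrapolation parameters of the accelerated method. -/
structure IsExtrapolation (γ : ℕ → ℝ) : Prop where
  zero : γ 0 = 1
  succ : ∀ k, γ (k + 1) = (√(γ k ^ 4 + 4 * γ k ^ 2) - γ k ^ 2) / 2

namespace IsExtrapolation

variable {γ : ℕ → ℝ} (hγ : IsExtrapolation γ)
include hγ

theorem pos_le_one (k : ℕ) : 0 < γ k ∧ γ k ≤ 1 := by
  induction k with
  | zero => simp [hγ.zero]
  | succ k ih =>
    have h := sqrt_recursion ih.1 ih.2
    rw [← hγ.succ] at h
    exact ⟨h.1, h.2.1⟩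

theorem recursion (k : ℕ) : γ (k + 1) ≤ γ k ∧ γ (k + 1) ^ 2 = γ k ^ 2 * (1 - γ (k + 1)) ∧
    (γ (k + 1))⁻¹ ≤ (γ k)⁻¹ + 1 := by
  have ih := hγ.pos_le_one k
  have h := sqrt_recursion ih.1 ih.2
  rw [← hγ.succ] at h
  exact h.2.2

theorem inv_le (k : ℕ) : (γ k)⁻¹ ≤ k + 1 := by
  induction k with
  | zero => simp [hγ.zero]
  | succ k ih =>
    push_cast
    linarith [(hγ.recursion k).2.2]

theorem one_le_inv (k : ℕ) : 1 ≤ (γ k)⁻¹ :=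
  (one_le_inv₀ (hγ.pos_le_one k).1).2 (hγ.pos_le_one k).2

theorem monotone_inv : Monotone fun k => (γ k)⁻¹ :=
  monotone_nat_of_le_succ fun k =>
    inv_anti₀ (hγ.pos_le_one (k + 1)).1 (hγ.recursion k).1

/-- This identity makes the averaging recursion telescope: with `T = γ⁻¹`, weighting `y` by `T ^ 2 -
T` turns it into a sum of the terms `T k * z (k + 1)`. -/
theorem inv_sq_sub (k : ℕ) : (γ (k + 1))⁻¹ ^ 2 - (γ (k + 1))⁻¹ = (γ k)⁻¹ ^ 2 := by
  have h := (hγ.recursion k).2.1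
  have h0 := (hγ.pos_le_one k).1.ne'
  have h1 := (hγ.pos_le_one (k + 1)).1.ne'
  field_simp
  linarith

end IsExtrapolation

/-- The averaged iterates inherit the lower bound of the profiles they average. -/
theorem lower_bound_of_averaging {γ y z A : ℕ → ℝ} (hγ : IsExtrapolation γ) {κ β : ℝ}
    (hβ : 0 ≤ β) (hκ : 0 ≤ κ) (hA : Monotone A) (hA0 : A 0 = 0)
    (hz : ∀ k, κ * (1 + A k) ^ (-β) ≤ z k)
    (hy : ∀ k, y (k + 1) = (1 - γ k) * y k + γ k * z (k + 1)) {k : ℕ} (hk : 1 ≤ k) :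
    κ * (1 + A k) ^ (-β) ≤ y k := by
  have hAnn : ∀ k, 0 ≤ A k := fun k => hA0 ▸ hA k.zero_le
  induction k, hk using Nat.le_induction with
  | base =>
    -- As `γ 0 = 1`, the first averaged iterate forgets the initial value; this is why the bound
    -- starts at `k = 1`.
    rw [hy 0, hγ.zero]
    simpa using hz 1
  | succ k hk ih =>
    have h1 := hγ.pos_le_one k
    have h2 : κ * (1 + A (k + 1)) ^ (-β) ≤ κ * (1 + A k) ^ (-β) := by
      have := hA k.le_succ
      have := Real.rpow_le_rpow_of_nonpos (z := -β) (by linarith [hAnn k] : 0 < 1 + A k)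
        (by linarith : 1 + A k ≤ 1 + A (k + 1)) (by linarith)
      gcongr
    rw [hy]
    have h3 := hz (k + 1)
    nlinarith

/-- The scalar dynamics of the accelerated method, where `y` are the values of the averaged
iterates, `z` those of the profiles, and `A` the accumulated step-sizes. -/
structure IsScalarAPGM (R' : ℝ → ℝ) (s : ℝ) (ζ : ℝ → ℝ) (γ y A : ℕ → ℝ) : Prop where
  extrapolation : IsExtrapolation γ
  A_zero : A 0 = 0
  A_succ : ∀ k, A (k + 1) = A k + s * R' ((1 - γ k) * y k + γ k * ζ (A k)) / γ k
  y_succ : ∀ k, y (k + 1) = (1 - γ k) * y k + γ k * ζ (A (k + 1))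

/-- Lower bound for a linear objective. -/
theorem exists_lower_bound_linear {s κ β : ℝ} (hs : 0 < s) (hκ : 0 < κ) (hβ : 0 < β) {ζ : ℝ → ℝ}
    (hζ : ∀ a, 0 ≤ a → κ * (1 + a) ^ (-β) ≤ ζ a) :
    ∃ c : ℝ, 0 < c ∧ ∀ γ y A : ℕ → ℝ, IsScalarAPGM (fun _ => 1) s ζ γ y A →
      ∀ k : ℕ, 1 ≤ k → c * (k : ℝ) ^ (-(2 * β)) ≤ y k := by
  refine ⟨κ * (1 + s) ^ (-β), by positivity, ?_⟩
  intro γ y A h k hk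
  have hγ := h.extrapolation
  have hmono : Monotone A := monotone_nat_of_le_succ fun k => by
    rw [h.A_succ]
    have := (hγ.pos_le_one k).1
    have : 0 < s * 1 / γ k := by positivity
    linarith
  have hAnn : ∀ k, 0 ≤ A k := fun k => h.A_zero ▸ hmono k.zero_le
  have hA : ∀ k : ℕ, A k ≤ s * (k : ℝ) ^ 2 := by
    intro k
    induction k with
    | zero => simp [h.A_zero]
    | succ k ih =>
      rw [h.A_succ, mul_one, div_eq_mul_inv]
      have := mul_le_mul_of_nonneg_left (hγ.inv_le k) hs.le
      have : 0 ≤ s * (k : ℝ) := by positivity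
      push_cast
      linarith
  have h1 := lower_bound_of_averaging hγ hβ.le hκ.le hmono h.A_zero
    (fun k => hζ _ (hAnn k)) h.y_succ hk
  refine le_trans ?_ h1
  have hk' : (1 : ℝ) ≤ k := by exact_mod_cast hk
  rw [mul_assoc]
  refine mul_le_mul_of_nonneg_left ?_ hκ.le
  have e : (k : ℝ) ^ (-(2 * β)) = ((k : ℝ) ^ 2) ^ (-β) := by
    rw [← Real.rpow_natCast, ← Real.rpow_mul (by positivity)]
    congr 1
    push_cast
    ring
  rw [e, ← Real.mul_rpow (by positivity) (by positivity)]
  refine Real.rpow_le_rpow_of_nonpos (by linarith [hAnn k]) ?_ (by linarith)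
  nlinarith [hA k]

/-- Lower bound for a quadratic objective. -/
theorem exists_lower_bound_quadratic {s κ K β : ℝ} (hs : 0 < s) (hκ : 0 < κ) (hK : 0 < K)
    (hβ : 0 < β) (hβ1 : β < 1) {ζ : ℝ → ℝ}
    (hζ : ∀ a, 0 ≤ a → κ * (1 + a) ^ (-β) ≤ ζ a)
    (hζ' : ∀ a, 0 ≤ a → ζ a ≤ K * (1 + a) ^ (-β)) :
    ∃ c : ℝ, 0 < c ∧ ∀ γ y A : ℕ → ℝ, IsScalarAPGM (fun x => x) s ζ γ y A → 0 ≤ y 0 →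
      ∀ k : ℕ, 1 ≤ k → c * (k : ℝ) ^ (-(2 * β / (1 + β))) ≤ y k := by
  obtain ⟨C, hC, hgrowth⟩ := exists_growth_bound hβ hβ1 hs hK
  refine ⟨κ * (2 * C) ^ (-(2 * β / (1 + β))), by positivity, ?_⟩
  intro γ y A h hy0 k hk
  have hγ := h.extrapolation
  have hnn : ∀ k, 0 ≤ A k ∧ 0 ≤ y k := by
    intro k
    induction k with
    | zero => exact ⟨h.A_zero.ge, hy0⟩
    | succ k ih =>
      have hg := hγ.pos_le_one k
      have h1 : 0 ≤ 1 - γ k := by linarith [hg.2]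
      have hpos : ∀ a, 0 ≤ a → 0 ≤ ζ a := fun a ha => le_trans (by positivity) (hζ a ha)
      have hA : 0 ≤ A (k + 1) := by
        rw [h.A_succ]
        have := hpos _ ih.1
        have := ih.1
        have := ih.2
        have := hg.1
        positivity
      refine ⟨hA, ?_⟩
      rw [h.y_succ]
      have := hpos _ hA
      have := ih.2
      have := hg.1
      positivity
  have hpos : ∀ k, 0 ≤ ζ (A k) := fun k =>
    le_trans (by have := (hnn k).1; positivity) (hζ _ (hnn k).1)
  have hmono : Monotone A := monotone_nat_of_le_succ fun k => by
    rw [h.A_succ]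
    have hg := hγ.pos_le_one k
    have h1 : 0 ≤ 1 - γ k := by linarith [hg.2]
    have := hpos k
    have := (hnn k).2
    have := hg.1
    have : 0 ≤ s * ((1 - γ k) * y k + γ k * ζ (A k)) / γ k := by positivity
    linarith
  -- The weight `(γ k)⁻¹ ^ 2 - (γ k)⁻¹` vanishes at `k = 0` and puts the dynamics in the form
  -- required by `exists_growth_bound`.
  have hB := hgrowth (fun k => (γ k)⁻¹) (fun k => ζ (A k))
    (fun k => ((γ k)⁻¹ ^ 2 - (γ k)⁻¹) * y k) A hγ.one_le_inv hγ.monotone_inv (by simp [hγ.zero])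
    (fun k => by
      have := (hγ.pos_le_one k).1.ne'
      rw [hγ.inv_sq_sub, h.y_succ]
      field_simp)
    (fun k => by
      have := (hγ.pos_le_one k).1.ne'
      rw [h.A_succ]
      field_simp
      ring) h.A_zero hpos (fun k => hζ' _ (hnn k).1) k
  have h1 := lower_bound_of_averaging hγ hβ.le hκ.le hmono h.A_zero
    (fun k => hζ _ (hnn k).1) h.y_succ hk
  refine le_trans ?_ h1
  have hk' : (1 : ℝ) ≤ k := by exact_mod_cast hk
  rw [mul_assoc]
  refine mul_le_mul_of_nonneg_left ?_ hκ.le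
  have hB0 : 0 < 1 + A k := by linarith [(hnn k).1]
  have e : (1 + A k) ^ (-β) = ((1 + A k) ^ ((1 + β) / 2)) ^ (-(2 * β / (1 + β))) := by
    rw [← Real.rpow_mul hB0.le]
    congr 1
    field_simp
  rw [e, ← Real.mul_rpow (by positivity) (by positivity)]
  refine Real.rpow_le_rpow_of_nonpos (by positivity) ?_ (neg_nonpos.2 (by positivity))
  -- The factor 2 in `2 * C` absorbs `k + 1 ≤ 2 * k`.
  refine hB.trans ?_
  nlinarith

/-! ### Truncated affine profiles -/

/-- The level `c` for which `(c - a Φ)₊` is a probability density. -/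
noncomputable def level {Θ : Type*} [MeasurableSpace Θ] (τ : Measure Θ) (Φ : Θ → ℝ) (a : ℝ) : ℝ :=
  Classical.epsilon fun c => 0 < c ∧ ∫ θ, max (c - a * Φ θ) 0 ∂τ = 1

/-- The probability density of the form `(c - a Φ)₊`. -/
noncomputable def profile {Θ : Type*} [MeasurableSpace Θ] (τ : Measure Θ) (Φ : Θ → ℝ) (a : ℝ)
    (θ : Θ) : ℝ :=
  max (level τ Φ a - a * Φ θ) 0

/-- The integral of `Φ` against the density `(c - a Φ)₊`. -/
noncomputable def profileValue {Θ : Type*} [MeasurableSpace Θ] (τ : Measure Θ) (Φ : Θ → ℝ)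
    (a : ℝ) : ℝ :=
  ∫ θ, Φ θ * profile τ Φ a θ ∂τ

/-- A measurable function with values in `[0, M]`. -/
structure IsPotential {Θ : Type*} [MeasurableSpace Θ] (Φ : Θ → ℝ) (M : ℝ) : Prop where
  measurable : Measurable Φ
  nonneg : ∀ θ, 0 ≤ Φ θ
  le : ∀ θ, Φ θ ≤ M

namespace IsPotential

variable {Θ : Type*} [MeasurableSpace Θ] {τ : Measure Θ} [IsProbabilityMeasure τ] {Φ : Θ → ℝ}
  {M : ℝ} (hΦ : IsPotential Φ M)
include hΦ

theorem integrable : Integrable Φ τ :=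
  Integrable.of_bound hΦ.measurable.aestronglyMeasurable M
    (ae_of_all _ fun θ => by rw [Real.norm_of_nonneg (hΦ.nonneg θ)]; exact hΦ.le θ)

omit [IsProbabilityMeasure τ] in
theorem integrable_mul {u : Θ → ℝ} (hu : Integrable u τ) :
    Integrable (fun θ => Φ θ * u θ) τ :=
  hu.bdd_mul hΦ.measurable.aestronglyMeasurable (c := M)
    (ae_of_all _ fun θ => by rw [Real.norm_of_nonneg (hΦ.nonneg θ)]; exact hΦ.le θ)

theorem integrable_truncated (c a : ℝ) : Integrable (fun θ => max (c - a * Φ θ) 0) τ :=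
  ((integrable_const c).sub (hΦ.integrable.const_mul a)).pos_part

/-- Intermediate values: the mass is 1-Lipschitz in `c`, zero at `c = 0` and at least one at `c = 1
+ a * M`. This gives content to the choice made in `level`. -/
theorem exists_level {a : ℝ} (ha : 0 ≤ a) :
    ∃ c, 0 < c ∧ ∫ θ, max (c - a * Φ θ) 0 ∂τ = 1 := by
  have hM : 0 ≤ M := by
    obtain ⟨θ⟩ := τ.nonempty_of_neZero
    exact (hΦ.nonneg θ).trans (hΦ.le θ)
  have hcont : Continuous fun c : ℝ => ∫ θ, max (c - a * Φ θ) 0 ∂τ := by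
    refine (LipschitzWith.of_dist_le_mul (K := 1) fun c c' => ?_).continuous
    rw [Real.dist_eq, ← integral_sub (hΦ.integrable_truncated _ _) (hΦ.integrable_truncated _ _)]
    have h := norm_integral_le_of_norm_le_const (μ := τ)
      (f := fun θ => max (c - a * Φ θ) 0 - max (c' - a * Φ θ) 0) (C := dist c c')
      (ae_of_all _ fun θ => ?_)
    · simpa using h
    refine (abs_max_sub_max_le_abs _ _ _).trans (le_of_eq ?_)
    rw [Real.dist_eq]
    congr 1
    ring
  have h0 : ∫ θ, max (0 - a * Φ θ) 0 ∂τ = 0 := by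
    have : (fun θ => max (0 - a * Φ θ) 0) = fun _ => (0 : ℝ) := by
      ext θ
      have := mul_nonneg ha (hΦ.nonneg θ)
      simp [this]
    rw [this, integral_zero]
  have h1 : 1 ≤ ∫ θ, max (1 + a * M - a * Φ θ) 0 ∂τ := by
    have h := integral_mono (μ := τ) (integrable_const (1 : ℝ))
      (hΦ.integrable_truncated (1 + a * M) a) fun θ => by
        have := mul_le_mul_of_nonneg_left (hΦ.le θ) ha
        exact le_max_of_le_left (by linarith)
    simpa using h
  obtain ⟨c, hc, hc1⟩ := intermediate_value_Icc (by positivity : 0 ≤ 1 + a * M) hcont.continuousOn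
    (show (1 : ℝ) ∈ Icc _ _ from ⟨h0.le.trans zero_le_one, h1⟩)
  refine ⟨c, lt_of_le_of_ne hc.1 ?_, hc1⟩
  rintro rfl
  simp only [h0] at hc1
  exact zero_ne_one hc1

variable (τ) in
theorem level_spec {a : ℝ} (ha : 0 ≤ a) :
    0 < level τ Φ a ∧ ∫ θ, profile τ Φ a θ ∂τ = 1 :=
  Classical.epsilon_spec (hΦ.exists_level (τ := τ) ha)

variable (τ) in
theorem integrable_profile (a : ℝ) : Integrable (profile τ Φ a) τ :=
  hΦ.integrable_truncated _ _

omit hΦ [IsProbabilityMeasure τ] in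
theorem _root_.profile_nonneg (a : ℝ) (θ : Θ) : 0 ≤ profile τ Φ a θ :=
  le_max_right _ _

variable (τ) in
theorem profile_le_level {a : ℝ} (ha : 0 ≤ a) (θ : Θ) : profile τ Φ a θ ≤ level τ Φ a :=
  max_le (by have := mul_nonneg ha (hΦ.nonneg θ); linarith) (hΦ.level_spec τ ha).1.le

variable (τ) in
theorem level_le {a : ℝ} (ha : 0 ≤ a) : level τ Φ a ≤ 1 + a * M := by
  have h := integral_mono (μ := τ) (integrable_const (level τ Φ a - a * M))
    (hΦ.integrable_profile τ a) fun θ => by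
      have := mul_le_mul_of_nonneg_left (hΦ.le θ) ha
      exact le_max_of_le_left (by linarith)
  rw [(hΦ.level_spec τ ha).2] at h
  simp only [integral_const, probReal_univ, one_smul] at h
  linarith

variable (τ) in
theorem profile_zero (θ : Θ) : profile τ Φ 0 θ = 1 := by
  have h := hΦ.level_spec τ le_rfl
  have h1 : ∀ θ, profile τ Φ 0 θ = level τ Φ 0 := fun θ => by
    simp only [profile, zero_mul, sub_zero]
    exact max_eq_left h.1.le
  have h2 := h.2
  simp only [h1, integral_const, probReal_univ, one_smul] at h2
  rw [h1, h2]

variable (τ) in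
/-- The supports of the profiles decrease. -/
theorem level_mul_le {a a' : ℝ} (ha : 0 ≤ a) (haa : a ≤ a') :
    level τ Φ a' * a ≤ level τ Φ a * a' := by
  by_contra! hlt
  obtain ⟨hc, hm⟩ := hΦ.level_spec τ ha
  obtain ⟨hc', hm'⟩ := hΦ.level_spec τ (ha.trans haa)
  have ha0 : 0 < a := by
    rcases ha.eq_or_lt with rfl | h
    · have := mul_nonneg hc.le haa
      simp only [mul_zero] at hlt
      linarith
    · exact h
  have hr : 1 ≤ a' / a := (one_le_div ha0).2 haa
  have ht : level τ Φ a * a' / (level τ Φ a' * a) < 1 := by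
    rw [div_lt_one (by positivity)]
    exact hlt
  -- If the support grew strictly, the old profile scaled by `a' / a ≥ 1` would lie below the new
  -- one scaled by a number less than 1. Both have mass one, a contradiction.
  have key : ∀ θ, a' / a * profile τ Φ a θ ≤
      level τ Φ a * a' / (level τ Φ a' * a) * profile τ Φ a' θ := by
    intro θ
    set t := level τ Φ a * a' / (level τ Φ a' * a) with ht_def
    have ha' : 0 ≤ a' := ha.trans haa
    have ht0 : 0 ≤ t := by positivity
    have hp := profile_nonneg (τ := τ) (Φ := Φ) a' θ
    have hX : 0 ≤ a' * Φ θ := mul_nonneg (ha.trans haa) (hΦ.nonneg θ)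
    rw [profile, mul_max_of_nonneg _ _ (by positivity), mul_zero]
    refine max_le ?_ (by positivity)
    calc a' / a * (level τ Φ a - a * Φ θ) = t * level τ Φ a' - a' * Φ θ := by
          rw [ht_def]
          field_simp
      _ ≤ t * (level τ Φ a' - a' * Φ θ) := by nlinarith
      _ ≤ t * profile τ Φ a' θ := mul_le_mul_of_nonneg_left (le_max_left _ _) ht0
  have h := integral_mono (μ := τ) ((hΦ.integrable_profile τ a).const_mul _)
    ((hΦ.integrable_profile τ a').const_mul _) key
  rw [integral_const_mul, integral_const_mul, hm, hm'] at h
  linarith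

variable (τ) in
/-- Optimality condition for the projection step, pointwise. -/
theorem optimality {a a' : ℝ} (ha : 0 ≤ a) (haa : a ≤ a') {v : ℝ} (hv : 0 ≤ v) (θ : Θ) :
    (level τ Φ a' - level τ Φ a) * (v - profile τ Φ a' θ) ≤
      ((a' - a) * Φ θ + profile τ Φ a' θ - profile τ Φ a θ) * (v - profile τ Φ a' θ) := by
  obtain ⟨hc, -⟩ := hΦ.level_spec τ ha
  obtain ⟨hc', -⟩ := hΦ.level_spec τ (ha.trans haa)
  have hle := hΦ.level_mul_le τ ha haa
  have hx := hΦ.nonneg θ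
  simp only [profile]
  set c := level τ Φ a
  set c' := level τ Φ a'
  set x := Φ θ
  -- Where the new profile is positive the old one is not truncated, because supports shrink, and
  -- equality holds. Where the new one vanishes only the sign of the coefficient of `v ≥ 0` matters.
  rcases le_or_gt (c' - a' * x) 0 with h1 | h1
  · rw [max_eq_right h1]
    have : c' - c ≤ (a' - a) * x + 0 - max (c - a * x) 0 := by
      rcases le_or_gt (c - a * x) 0 with h2 | h2
      · rw [max_eq_right h2]
        have ha0 : 0 < a := by
          rcases ha.eq_or_lt with rfl | h
          · linarith
          · exact h
        have h3 : (c' - c) * a ≤ (a' - a) * x * a := by nlinarith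
        have := le_of_mul_le_mul_right h3 ha0
        linarith
      · rw [max_eq_left h2.le]
        linarith
    have := mul_le_mul_of_nonneg_right this hv
    simpa using this
  · have h2 : 0 ≤ c - a * x := by
      by_contra! h2
      have : c * a' < c' * a := by
        have e1 : c * a' ≤ a * x * a' := by nlinarith [ha.trans haa]
        rcases ha.eq_or_lt with h | h
        · rw [← h] at h2
          linarith
        · nlinarith
      linarith
    rw [max_eq_left h1.le, max_eq_left h2]
    refine le_of_eq ?_
    ring

omit [IsProbabilityMeasure τ] in
theorem profileValue_nonneg (a : ℝ) : 0 ≤ profileValue τ Φ a :=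
  integral_nonneg fun θ => mul_nonneg (hΦ.nonneg θ) (profile_nonneg _ _)

variable (τ) in
theorem profileValue_le {a : ℝ} (ha : 0 ≤ a) : profileValue τ Φ a ≤ M := by
  have h := integral_mono (μ := τ) (hΦ.integrable_mul (hΦ.integrable_profile τ a))
    ((hΦ.integrable_profile τ a).const_mul M)
    (fun θ => mul_le_mul_of_nonneg_right (hΦ.le θ) (profile_nonneg _ _))
  rwa [integral_const_mul, (hΦ.level_spec τ ha).2, mul_one] at h

variable (τ) in
-- On the support of the profile `a * Φ` stays below the level, and the profile has mass one. This
-- makes half of `profileValue` an admissible height in `level_mul_measure_le`.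
theorem mul_profileValue_le_level {a : ℝ} (ha : 0 ≤ a) :
    a * profileValue τ Φ a ≤ level τ Φ a := by
  have h := integral_mono (μ := τ) ((hΦ.integrable_mul (hΦ.integrable_profile τ a)).const_mul a)
    ((hΦ.integrable_profile τ a).const_mul (level τ Φ a))
    (fun θ => by
      simp only [← mul_assoc]
      rcases le_or_gt (level τ Φ a - a * Φ θ) 0 with h1 | h1
      · simp [profile, h1]
      · exact mul_le_mul_of_nonneg_right (by linarith) (profile_nonneg _ _))
  rwa [integral_const_mul, integral_const_mul, (hΦ.level_spec τ ha).2, mul_one] at h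

variable (τ) in
/-- Mass of a sublevel set in terms of the level. -/
theorem level_mul_measure_le {a t : ℝ} (ha : 0 ≤ a) (hat : a * t ≤ level τ Φ a / 2) :
    level τ Φ a / 2 * τ.real {θ | Φ θ ≤ t} ≤ 1 := by
  have hms : MeasurableSet {θ | Φ θ ≤ t} := measurableSet_le hΦ.measurable measurable_const
  rw [← (hΦ.level_spec τ ha).2, mul_comm, ← smul_eq_mul, ← setIntegral_const]
  refine (setIntegral_mono_on (integrableOn_const (by simp) (by simp))
    (hΦ.integrable_profile τ a).integrableOn hms fun θ hθ => ?_).trans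
    (setIntegral_le_integral (hΦ.integrable_profile τ a)
      (ae_of_all _ fun θ => profile_nonneg _ _))
  have : a * Φ θ ≤ a * t := mul_le_mul_of_nonneg_left hθ ha
  exact le_max_of_le_left (by linarith)

variable (τ) in
/-- Lower bound on the integral of the potential, from the level and the mass of a sublevel set. -/
theorem le_profileValue {a t : ℝ} (ha : 0 ≤ a) (ht : 0 ≤ t)
    (h : level τ Φ a * τ.real {θ | Φ θ ≤ t} ≤ 1 / 2) : t / 2 ≤ profileValue τ Φ a := by
  have hms : MeasurableSet {θ | Φ θ ≤ t} := measurableSet_le hΦ.measurable measurable_const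
  have hint := hΦ.integrable_profile τ a
  -- The density never exceeds the level, so the sublevel set holds at most half the mass; the other
  -- half sits where `Φ` exceeds `t`.
  have h1 : ∫ θ in {θ | Φ θ ≤ t}, profile τ Φ a θ ∂τ ≤ 1 / 2 := by
    refine le_trans ?_ h
    rw [mul_comm, ← smul_eq_mul, ← setIntegral_const]
    exact setIntegral_mono_on hint.integrableOn (integrableOn_const (by simp) (by simp)) hms
      fun θ _ => hΦ.profile_le_level τ ha θ
  have h2 := integral_add_compl hms hint
  rw [(hΦ.level_spec τ ha).2] at h2
  have h3 : t * ∫ θ in {θ | Φ θ ≤ t}ᶜ, profile τ Φ a θ ∂τ ≤ profileValue τ Φ a := by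
    rw [← integral_const_mul]
    refine (setIntegral_mono_on (hint.integrableOn.const_mul t)
      (hΦ.integrable_mul hint).integrableOn hms.compl fun θ hθ => ?_).trans
      (setIntegral_le_integral (hΦ.integrable_mul hint)
        (ae_of_all _ fun θ => mul_nonneg (hΦ.nonneg θ) (profile_nonneg _ _)))
    exact mul_le_mul_of_nonneg_right (not_le.1 (show ¬ Φ θ ≤ t from hθ)).le (profile_nonneg _ _)
  have h4 : 1 / 2 ≤ ∫ θ in {θ | Φ θ ≤ t}ᶜ, profile τ Φ a θ ∂τ := by linarith
  nlinarith

/-- Decay of the integral of the potential along the profiles, when the sublevel sets have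
polynomial volume growth. -/
theorem exists_profileValue_bounds {α κ K : ℝ} (hα : 0 < α) (hκ : 0 < κ) (hK : 0 < K) (hM : 1 ≤ M)
    (hlow : ∀ t, 0 < t → t ≤ M → κ * t ^ α ≤ τ.real {θ | Φ θ ≤ t})
    (hup : ∀ t, 0 < t → τ.real {θ | Φ θ ≤ t} ≤ K * t ^ α) :
    ∃ κ' K' : ℝ, 0 < κ' ∧ 0 < K' ∧ ∀ a, 0 ≤ a →
      κ' * (1 + a) ^ (-(1 / (1 + α))) ≤ profileValue τ Φ a ∧
      profileValue τ Φ a ≤ K' * (1 + a) ^ (-(1 / (1 + α))) := by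
  have hα1 : 0 < 1 + α := by linarith
  have hlevel : ∀ a, 0 ≤ a → level τ Φ a ≤
      (2 ^ (1 + α) / κ) ^ (1 / (1 + α)) * (1 + a) ^ (α / (1 + α)) := by
    intro a ha
    obtain ⟨hc, -⟩ := hΦ.level_spec τ ha
    have hle := hΦ.level_le τ ha
    set c := level τ Φ a
    have h1a : 0 < 1 + a := by linarith
    -- At this height `a * t ≤ c / 2`, and `t ≤ M` follows from `c ≤ 1 + a * M` and `1 ≤ M`.
    set t := c / (2 * (1 + a)) with ht
    have ht0 : 0 < t := by positivity
    have htM : t ≤ M := by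
      rw [ht, div_le_iff₀ (by positivity)]
      nlinarith
    have h1 := hΦ.level_mul_measure_le τ ha (t := t) (by
      rw [ht, ← mul_div_assoc, div_le_div_iff₀ (by positivity) (by positivity)]
      nlinarith)
    have h2 : c / 2 * (κ * t ^ α) ≤ 1 := le_trans
      (mul_le_mul_of_nonneg_left (hlow t ht0 htM) (by positivity)) h1
    have h3 : c ^ (1 + α) ≤ 2 ^ (1 + α) / κ * (1 + a) ^ α := by
      rw [ht, Real.div_rpow hc.le (by positivity), Real.mul_rpow (by positivity) h1a.le] at h2
      rw [Real.rpow_add hc, Real.rpow_add two_pos, Real.rpow_one, Real.rpow_one]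
      have e1 : 0 < (2 : ℝ) ^ α := by positivity
      have e2 : 0 < (1 + a) ^ α := by positivity
      field_simp at h2 ⊢
      linarith
    have h4 := Real.rpow_le_rpow (by positivity) h3 (show 0 ≤ 1 / (1 + α) by positivity)
    rw [← Real.rpow_mul hc.le, mul_one_div_cancel hα1.ne', Real.rpow_one,
      Real.mul_rpow (by positivity) (by positivity), ← Real.rpow_mul h1a.le, mul_one_div] at h4
    exact h4
  set C := (2 ^ (1 + α) / κ) ^ (1 / (1 + α)) with hC
  have hC0 : 0 < C := by positivity
  refine ⟨(1 / (2 * C * K)) ^ (1 / α) / 2, ((M ^ (1 + α) + 2 ^ (1 + α) / κ)) ^ (1 / (1 + α)),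
    by positivity, by positivity, fun a ha => ?_⟩
  have h1a : 0 < 1 + a := by linarith
  constructor
  -- This height solves `C * (1 + a) ^ (α / (1 + α)) * K * t ^ α = 1 / 2`, so at most half of the
  -- mass lies below it.
  · set t := (1 / (2 * C * K)) ^ (1 / α) * (1 + a) ^ (-(1 / (1 + α))) with ht
    have ht0 : 0 < t := by positivity
    have h := hΦ.le_profileValue τ ha ht0.le ?_
    · rw [ht] at h
      linarith
    refine (mul_le_mul (hlevel a ha) (hup t ht0) measureReal_nonneg (by positivity)).trans ?_
    have e : t ^ α = 1 / (2 * C * K) * (1 + a) ^ (-(α / (1 + α))) := by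
      rw [ht, Real.mul_rpow (by positivity) (by positivity), ← Real.rpow_mul (by positivity),
        ← Real.rpow_mul h1a.le, one_div_mul_cancel hα.ne', Real.rpow_one]
      congr 2
      ring
    have e2 : (1 + a) ^ (α / (1 + α)) * (1 + a) ^ (-(α / (1 + α))) = 1 := by
      rw [← Real.rpow_add h1a]
      simp
    rw [e]
    calc C * (1 + a) ^ (α / (1 + α)) * (K * (1 / (2 * C * K) * (1 + a) ^ (-(α / (1 + α))))) =
          C * K * (1 / (2 * C * K)) * ((1 + a) ^ (α / (1 + α)) * (1 + a) ^ (-(α / (1 + α)))) := by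
          ring
      _ ≤ 1 / 2 := by
          rw [e2]
          field_simp
          norm_num
  · set z := profileValue τ Φ a with hz
    have hz0 : 0 ≤ z := hΦ.profileValue_nonneg a
    have hzM : z ≤ M := hΦ.profileValue_le τ ha
    have hzc := hΦ.mul_profileValue_le_level τ ha
    have h1 : a * z ^ (1 + α) ≤ 2 ^ (1 + α) / κ := by
      rcases hz0.eq_or_lt with h0 | h0
      · rw [← h0, Real.zero_rpow hα1.ne', mul_zero]
        positivity
      have h1 := hΦ.level_mul_measure_le τ ha (t := z / 2) (by linarith)
      have h2 := hlow (z / 2) (by positivity) (by linarith)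
      have h3 : a * z / 2 * (κ * (z / 2) ^ α) ≤ 1 := by
        refine le_trans (mul_le_mul ?_ h2 (by positivity) ?_) h1
        · linarith
        · have := (hΦ.level_spec τ ha).1
          positivity
      rw [Real.div_rpow hz0 two_pos.le] at h3
      rw [Real.rpow_add h0, Real.rpow_add two_pos, Real.rpow_one, Real.rpow_one]
      have e1 : 0 < (2 : ℝ) ^ α := by positivity
      field_simp at h3 ⊢
      linarith
    -- The bound on `a * z ^ (1 + α)` says nothing at `a = 0`; adding `z ≤ M` replaces `a` by `1 +
    -- a`.
    have h2 : z ^ (1 + α) ≤ (M ^ (1 + α) + 2 ^ (1 + α) / κ) * (1 + a) ^ (-1 : ℝ) := by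
      rw [Real.rpow_neg_one, ← div_eq_mul_inv, le_div_iff₀ h1a]
      have := Real.rpow_le_rpow hz0 hzM hα1.le
      linarith
    have h4 := Real.rpow_le_rpow (by positivity) h2 (show 0 ≤ 1 / (1 + α) by positivity)
    rw [← Real.rpow_mul hz0, mul_one_div_cancel hα1.ne', Real.rpow_one,
      Real.mul_rpow (by positivity) (by positivity), ← Real.rpow_mul h1a.le] at h4
    convert h4 using 3
    ring

end IsPotential

/-! ### Charts of Riemannian manifolds are locally bi-Lipschitz -/

section BiLipschitz

variable {E : Type*} [NormedAddCommGroup E] [NormedSpace ℝ E]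
  {H : Type*} [TopologicalSpace H] (I : ModelWithCorners ℝ E H)
  {M : Type*} [MetricSpace M] [ChartedSpace H M]
  [RiemannianBundle (fun x : M => TangentSpace I x)]
  [IsManifold I 1 M] [IsContinuousRiemannianBundle E (fun x : M => TangentSpace I x)]
  [IsRiemannianManifold I M]

attribute [local instance] normedAddCommGroupTangentSpaceVectorSpace
  normedSpaceTangentSpaceVectorSpace

omit [IsRiemannianManifold I M] in
theorem eventually_enorm_mfderiv_extChartAt_apply_le (x : M) :
    ∃ C : ℝ≥0, ∀ᶠ y in 𝓝 x, ∀ v, ‖mfderiv% (extChartAt I x) y v‖ₑ ≤ C * ‖v‖ₑ := by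
  obtain ⟨C, C_pos, hC⟩ := eventually_enorm_mfderiv_extChartAt_lt I x
  refine ⟨C, hC.mono fun y hy v => ?_⟩
  have := fun v => ContinuousLinearMap.le_of_opENorm_le _ hy.le v
  exact this v

omit [IsRiemannianManifold I M] in
theorem eventually_enorm_mfderivWithin_symm_extChartAt_apply_le (x : M) :
    ∃ C : ℝ≥0, ∀ᶠ y in 𝓝[range I] (extChartAt I x x),
      ∀ v, ‖mfderiv[range I] (extChartAt I x).symm y v‖ₑ ≤ C * ‖v‖ₑ := by
  obtain ⟨C, C_pos, hC⟩ := eventually_enorm_mfderivWithin_symm_extChartAt_lt I x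
  refine ⟨C, hC.mono fun y hy v => ?_⟩
  have := fun v => ContinuousLinearMap.le_of_opENorm_le _ hy.le v
  exact this v

/-- The inverse of an extended chart is Lipschitz near the base point. -/
theorem exists_lipschitzOnWith_extChartAt_symm (x : M) :
    ∃ C : ℝ≥0, ∃ r > 0,
      Metric.ball (extChartAt I x x) r ∩ range I ⊆ (extChartAt I x).target ∧
      LipschitzOnWith C (extChartAt I x).symm (Metric.ball (extChartAt I x x) r ∩ range I) := by
  obtain ⟨C, hC⟩ := eventually_enorm_mfderivWithin_symm_extChartAt_apply_le I x
  obtain ⟨r, r_pos, hr⟩ : ∃ r > 0,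
      Metric.ball (extChartAt I x x) r ∩ range I ⊆ (extChartAt I x).target ∩
        {y | ∀ v, ‖mfderiv[range I] (extChartAt I x).symm y v‖ₑ ≤ C * ‖v‖ₑ} :=
    Metric.mem_nhdsWithin_iff.1 (Filter.inter_mem (extChartAt_target_mem_nhdsWithin x) hC)
  refine ⟨C, r, r_pos, fun y hy => (hr hy).1, fun a ha b hb => ?_⟩
  rw [IsRiemannianManifold.out (I := I)]
  -- The Riemannian distance is at most the length of the image of the segment, which stays in the
  -- region where the derivative is controlled by convexity.
  let η := ContinuousAffineMap.lineMap (R := ℝ) a b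
  set γ := (extChartAt I x).symm ∘ η
  have hη : Icc 0 1 ⊆ ⇑η ⁻¹' ((extChartAt I x).target ∩
        {y | ∀ v, ‖mfderiv[range I] (extChartAt I x).symm y v‖ₑ ≤ C * ‖v‖ₑ}) := by
    simp only [← image_subset_iff, ContinuousAffineMap.coe_lineMap_eq,
      ← segment_eq_image_lineMap, η]
    exact Subset.trans (((convex_ball _ _).inter I.convex_range).segment_subset ha hb) hr
  simp only [preimage_inter, subset_inter_iff] at hη
  have η_smooth : CMDiff[Icc 0 1] 1 η := by
    apply ContMDiff.contMDiffOn
    rw [contMDiff_iff_contDiff]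
    exact ContinuousAffineMap.contDiff _
  have : Manifold.riemannianEDist I ((extChartAt I x).symm a) ((extChartAt I x).symm b) ≤
      Manifold.pathELength I γ 0 1 := by
    apply Manifold.riemannianEDist_le_pathELength _ _ _ zero_le_one
    · exact (contMDiffOn_extChartAt_symm x).comp η_smooth hη.1
    · simp [γ, η, ContinuousAffineMap.coe_lineMap_eq]
    · simp [γ, η, ContinuousAffineMap.coe_lineMap_eq]
  apply this.trans
  rw [← lintegral_fderiv_lineMap_eq_edist, Manifold.pathELength_eq_lintegral_mfderivWithin_Icc,
    ← lintegral_const_mul' _ _ ENNReal.coe_ne_top]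
  apply setLIntegral_mono' measurableSet_Icc (fun t ht ↦ ?_)
  have : mfderiv[Icc 0 1] γ t =
      (mfderiv[range I] (extChartAt I x).symm (η t)) ∘L (mfderiv[Icc 0 1] η t) := by
    apply mfderivWithin_comp
    · exact mdifferentiableWithinAt_extChartAt_symm (hη.1 ht)
    · exact η_smooth.mdifferentiableOn one_ne_zero t ht
    · exact hη.1.trans (preimage_mono (extChartAt_target_subset_range x))
    · rw [uniqueMDiffWithinAt_iff_uniqueDiffWithinAt]
      exact uniqueDiffOn_Icc zero_lt_one t ht
  have : mfderiv[Icc 0 1] γ t 1 =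
      (mfderiv[range I] (extChartAt I x).symm (η t)) (mfderiv[Icc 0 1] η t 1) := congr($this 1)
  rw [this]
  refine (hη.2 ht _).trans ?_
  simp only [mfderivWithin_eq_fderivWithin]
  exact le_of_eq rfl

/-- An extended chart is Lipschitz near the base point. -/
theorem exists_lipschitzOnWith_extChartAt (x : M) :
    ∃ C : ℝ≥0, ∃ V ∈ 𝓝 x, V ⊆ (extChartAt I x).source ∧ LipschitzOnWith C (extChartAt I x) V := by
  obtain ⟨C, hC⟩ := eventually_enorm_mfderiv_extChartAt_apply_le I x
  obtain ⟨ε, ε_pos, hε⟩ : ∃ ε > 0, Metric.ball x ε ⊆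
      {y | ∀ v, ‖mfderiv% (extChartAt I x) y v‖ₑ ≤ C * ‖v‖ₑ} ∩ (extChartAt I x).source :=
    Metric.mem_nhds_iff.1 (Filter.inter_mem hC (extChartAt_source_mem_nhds (I := I) x))
  -- The infimum defining the distance need not be attained, so a path of length below twice the
  -- distance is used. For endpoints within `ε / 8` of `x` it stays within `5 * ε / 8`, inside the
  -- controlled ball.
  refine ⟨C * 2, Metric.ball x (ε / 8), Metric.ball_mem_nhds _ (by positivity),
    fun y hy => (hε (Metric.ball_subset_ball (by linarith) hy)).2, fun y hy z hz => ?_⟩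
  rcases eq_or_ne y z with rfl | hyz
  · simp
  have hlt : edist y z < 2 * edist y z := by
    conv_lhs => rw [← one_mul (edist y z)]
    exact ENNReal.mul_lt_mul_left (edist_pos.2 hyz).ne' (edist_ne_top _ _) (by norm_num)
  rw [IsRiemannianManifold.out (I := I) y z] at hlt
  obtain ⟨γ, hγ0, hγ1, γ_smooth, hγ⟩ := Manifold.exists_lt_of_riemannianEDist_lt hlt
  rw [← IsRiemannianManifold.out (I := I) y z] at hγ
  have hγmem : ∀ t ∈ Icc (0 : ℝ) 1, γ t ∈ Metric.ball x ε := by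
    intro t ht
    have h1 : edist y (γ t) ≤ 2 * edist y z := by
      rw [IsRiemannianManifold.out (I := I) y (γ t)]
      refine (Manifold.riemannianEDist_le_pathELength
        (γ_smooth.mono (Icc_subset_Icc le_rfl ht.2)) hγ0 rfl ht.1).trans (le_trans ?_ hγ.le)
      exact Manifold.pathELength_mono le_rfl ht.2
    have h2 : dist y (γ t) ≤ 2 * dist y z := by
      rw [edist_dist, edist_dist] at h1
      rw [← ENNReal.ofReal_ofNat 2, ← ENNReal.ofReal_mul (by norm_num)] at h1
      exact (ENNReal.ofReal_le_ofReal_iff (by positivity)).1 h1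
    rw [Metric.mem_ball] at hy hz ⊢
    have h3 := dist_triangle (γ t) y x
    have h4 := dist_triangle_right y z x
    rw [dist_comm] at h2
    linarith
  let γ' := extChartAt I x ∘ γ
  have hC' : CMDiff[Icc 0 1] 1 γ' :=
    contMDiffOn_extChartAt.comp (I' := I) (t := (chartAt H x).source)
      γ_smooth (fun t ht => by
        have h := (hε (hγmem t ht)).2
        rw [extChartAt_source] at h
        exact h)
  calc edist (extChartAt I x y) (extChartAt I x z) = ‖γ' 1 - γ' 0‖ₑ := by
        rw [edist_comm, edist_eq_enorm_sub]
        simp [γ', hγ0, hγ1]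
    _ ≤ ∫⁻ t in Icc 0 1, ‖derivWithin γ' (Icc 0 1) t‖ₑ := by
        apply enorm_sub_le_lintegral_derivWithin_Icc_of_contDiffOn_Icc _ zero_le_one
        rwa [← contMDiffOn_iff_contDiffOn]
    _ = ∫⁻ t in Icc 0 1, ‖mfderiv[Icc 0 1] γ' t 1‖ₑ := by
        simp_rw [← fderivWithin_derivWithin, mfderivWithin_eq_fderivWithin]
        rfl
    _ ≤ ∫⁻ t in Icc 0 1, C * ‖mfderiv[Icc 0 1] γ t 1‖ₑ := by
        apply setLIntegral_mono' measurableSet_Icc (fun t ht => ?_)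
        have : mfderiv[Icc 0 1] γ' t =
            (mfderiv% (extChartAt I x) (γ t)) ∘L (mfderiv[Icc 0 1] γ t) := by
          apply mfderiv_comp_mfderivWithin
          · exact mdifferentiableAt_extChartAt
              (by simpa only [extChartAt_source] using (hε (hγmem t ht)).2)
          · exact γ_smooth.mdifferentiableOn one_ne_zero _ ht
          · rw [uniqueMDiffWithinAt_iff_uniqueDiffWithinAt]
            exact uniqueDiffOn_Icc zero_lt_one _ ht
        have : mfderiv[Icc 0 1] γ' t 1 =
            (mfderiv% (extChartAt I x) (γ t)) (mfderiv[Icc 0 1] γ t 1) := congr($this 1)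
        rw [this]
        exact (hε (hγmem t ht)).1 _
    _ = C * Manifold.pathELength I γ 0 1 := by
        rw [lintegral_const_mul' _ _ ENNReal.coe_ne_top,
          Manifold.pathELength_eq_lintegral_mfderivWithin_Icc]
    _ ≤ C * (2 * edist y z) := by gcongr
    _ = (C * 2 : ℝ≥0) * edist y z := by
        push_cast
        ring

end BiLipschitz

/-! ### Volume of small balls -/

section Volume

variable {d : ℕ} {Θ : Type*} [MetricSpace Θ] [MeasurableSpace Θ] [BorelSpace Θ]
  [ChartedSpace (EuclideanSpace ℝ (Fin d)) Θ] [IsManifold (𝓡 d) 1 Θ]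
  [RiemannianBundle (fun x : Θ => TangentSpace (𝓡 d) x)]
  [IsContinuousRiemannianBundle (EuclideanSpace ℝ (Fin d))
    (fun x : Θ => TangentSpace (𝓡 d) x)]
  [IsRiemannianManifold (𝓡 d) Θ]

omit [MetricSpace Θ] [BorelSpace Θ] in
theorem smul_ne_zero_ne_top {μ τ : Measure Θ} [IsProbabilityMeasure τ] {c : ℝ≥0∞}
    (h : τ = c • μ) : c ≠ 0 ∧ c ≠ ⊤ := by
  have h1 : c * μ univ = 1 := by
    rw [← smul_eq_mul, ← Measure.smul_apply, ← h, measure_univ]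
  constructor
  · rintro rfl
    simp at h1
  · rintro rfl
    rcases eq_or_ne (μ univ) 0 with h0 | h0
    · simp [h0] at h1
    · simp [ENNReal.top_mul h0] at h1

/-- A Lipschitz map distorts `d`-dimensional Hausdorff measure by at most the `d`-th power of its
constant. The chart and its inverse transfer the Euclidean scaling `r ^ d` of balls to `Θ`. -/
theorem exists_hausdorffMeasure_closedBall_bounds (x : Θ) :
    ∃ ρ : ℝ, 0 < ρ ∧ ∃ a b : ℝ, 0 < a ∧ 0 < b ∧ ∀ r, 0 < r → r ≤ ρ →
      ENNReal.ofReal (a * r ^ d) ≤ μH[d] (Metric.closedBall x r) ∧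
      μH[d] (Metric.closedBall x r) ≤ ENNReal.ofReal (b * r ^ d) := by
  obtain ⟨C₁, V, hV, hVs, hC₁⟩ := exists_lipschitzOnWith_extChartAt (𝓡 d) x
  obtain ⟨C₂, r₂, hr₂, hsub, hC₂⟩ := exists_lipschitzOnWith_extChartAt_symm (𝓡 d) x
  replace hC₁ := hC₁.weaken (le_self_add (b := (1 : ℝ≥0)))
  replace hC₂ := hC₂.weaken (le_self_add (b := (1 : ℝ≥0)))
  have hpos₁ : 0 < C₁ + 1 := by positivity
  have hpos₂ : 0 < C₂ + 1 := by positivity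
  generalize C₁ + 1 = L₁ at hC₁ hpos₁
  generalize C₂ + 1 = L₂ at hC₂ hpos₂
  simp only [modelWithCornersSelf_coe, range_id, inter_univ] at hsub hC₂
  obtain ⟨ρ₁, hρ₁, hball⟩ := Metric.mem_nhds_iff.1 hV
  set φ := extChartAt (𝓡 d) x
  have hx : φ x ∈ Metric.ball (φ x) r₂ := Metric.mem_ball_self hr₂
  have hsymm : φ.symm (φ x) = x := φ.left_inv (mem_extChartAt_source x)
  have : (μH[d] : Measure (EuclideanSpace ℝ (Fin d))).IsAddHaarMeasure := by
    simpa using isAddHaarMeasure_hausdorffMeasure (E := EuclideanSpace ℝ (Fin d))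
  set m := (μH[d] : Measure (EuclideanSpace ℝ (Fin d))) (Metric.ball 0 1) with hm
  have hm0 : m ≠ 0 := (Metric.measure_ball_pos _ _ one_pos).ne'
  have hmt : m ≠ ⊤ := measure_ball_lt_top.ne
  have hcb : ∀ (y : EuclideanSpace ℝ (Fin d)) r, 0 ≤ r →
      μH[d] (Metric.closedBall y r) = ENNReal.ofReal (r ^ d * m.toReal) := by
    intro y r hr
    rw [Measure.addHaar_closedBall _ _ hr, finrank_euclideanSpace, Fintype.card_fin,
      ENNReal.ofReal_mul (by positivity), ENNReal.ofReal_toReal hmt]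
  have hmp : 0 < m.toReal := ENNReal.toReal_pos hm0 hmt
  have hL₁ : (0 : ℝ) < L₁ := hpos₁
  have hL₂ : (0 : ℝ) < L₂ := hpos₂
  refine ⟨min (ρ₁ / 2) (min (r₂ / L₁ / 2) (r₂ * L₂ / 2)), by positivity,
    m.toReal / (L₂ ^ d * L₁ ^ d), m.toReal * (L₂ ^ d * L₁ ^ d), by positivity, by positivity,
    fun r hr hle => ?_⟩
  have hle₁ : r ≤ ρ₁ / 2 := hle.trans (min_le_left _ _)
  have hle₂ : r ≤ r₂ / L₁ / 2 := hle.trans ((min_le_right _ _).trans (min_le_left _ _))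
  have hle₃ : r ≤ r₂ * L₂ / 2 := hle.trans ((min_le_right _ _).trans (min_le_right _ _))
  have hsubV : Metric.closedBall x r ⊆ V :=
    (Metric.closedBall_subset_ball (by linarith)).trans hball
  have hxV : x ∈ V := mem_of_mem_nhds hV
  constructor
  · have h1 : Metric.closedBall (φ x) (r / L₂) ⊆ φ '' Metric.closedBall x r := by
      intro y hy
      have hyb : y ∈ Metric.ball (φ x) r₂ := by
        refine Metric.closedBall_subset_ball ?_ hy
        rw [div_lt_iff₀ hL₂]
        have := mul_pos hr₂ hL₂
        linarith
      refine ⟨φ.symm y, ?_, φ.right_inv (hsub hyb)⟩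
      have := hC₂.dist_le_mul y hyb (φ x) hx
      rw [hsymm] at this
      rw [Metric.mem_closedBall] at hy ⊢
      rw [le_div_iff₀ hL₂] at hy
      linarith
    have h2 := (measure_mono h1).trans
      ((hC₁.mono hsubV).hausdorffMeasure_image_le (d := d) (by positivity))
    rw [hcb _ _ (by positivity), ENNReal.rpow_natCast] at h2
    have e : ENNReal.ofReal (m.toReal / (L₂ ^ d * L₁ ^ d) * r ^ d) =
        ((L₁ : ℝ≥0∞) ^ d)⁻¹ * ENNReal.ofReal ((r / L₂) ^ d * m.toReal) := by
      rw [← ENNReal.ofReal_coe_nnreal, ← ENNReal.ofReal_pow hL₁.le,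
        ← ENNReal.ofReal_inv_of_pos (by positivity), ← ENNReal.ofReal_mul (by positivity), div_pow]
      congr 1
      field_simp
    rw [e]
    refine (mul_le_mul_right h2 _).trans (le_of_eq ?_)
    rw [← mul_assoc, ENNReal.inv_mul_cancel (by simp [hpos₁.ne']) (by simp), one_mul]
  · have h1 : Metric.closedBall x r ⊆ φ.symm '' Metric.closedBall (φ x) (L₁ * r) := by
      intro y hy
      refine ⟨φ y, ?_, φ.left_inv (hVs (hsubV hy))⟩
      have := hC₁.dist_le_mul y (hsubV hy) x hxV
      rw [Metric.mem_closedBall] at hy ⊢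
      exact this.trans (mul_le_mul_of_nonneg_left hy hL₁.le)
    have h2 : Metric.closedBall (φ x) (L₁ * r) ⊆ Metric.ball (φ x) r₂ := by
      refine Metric.closedBall_subset_ball ?_
      rw [div_div, le_div_iff₀ (by positivity)] at hle₂
      have := mul_pos hL₁ hr
      linarith
    have h3 := (measure_mono h1).trans
      ((hC₂.mono h2).hausdorffMeasure_image_le (d := d) (by positivity))
    rw [hcb _ _ (by positivity), ENNReal.rpow_natCast] at h3
    refine h3.trans (le_of_eq ?_)
    rw [← ENNReal.ofReal_coe_nnreal, ← ENNReal.ofReal_pow hL₂.le,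
      ← ENNReal.ofReal_mul (by positivity)]
    congr 1
    ring

/-- Volume growth of balls for a normalized volume measure. -/
theorem exists_measure_closedBall_bounds (τ : Measure Θ) [IsProbabilityMeasure τ]
    (hτ : ∃ c : ℝ≥0∞, τ = c • (Measure.hausdorffMeasure (d : ℝ) : Measure Θ)) (x : Θ) {R : ℝ}
    (hR : 0 < R) :
    ∃ κ K : ℝ, 0 < κ ∧ 0 < K ∧
      (∀ r, 0 < r → r ≤ R → κ * r ^ d ≤ τ.real (Metric.closedBall x r)) ∧
      ∀ r, 0 < r → τ.real (Metric.closedBall x r) ≤ K * r ^ d := by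
  obtain ⟨c, hc⟩ := hτ
  obtain ⟨hc0, hct⟩ := smul_ne_zero_ne_top hc
  obtain ⟨ρ, hρ, a, b, ha, hb, hab⟩ := exists_hausdorffMeasure_closedBall_bounds (d := d) x
  have hcp : 0 < c.toReal := ENNReal.toReal_pos hc0 hct
  have hτ : ∀ r, τ.real (Metric.closedBall x r) =
      c.toReal * (μH[d] (Metric.closedBall x r)).toReal := by
    intro r
    conv_lhs => rw [measureReal_def, hc]
    rw [Measure.smul_apply, smul_eq_mul, ENNReal.toReal_mul]
  have hlow : ∀ r, 0 < r → r ≤ ρ → c.toReal * a * r ^ d ≤ τ.real (Metric.closedBall x r) := by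
    intro r hr hrρ
    rw [hτ, mul_assoc]
    refine mul_le_mul_of_nonneg_left ?_ hcp.le
    exact (ENNReal.ofReal_le_iff_le_toReal
      (ne_top_of_le_ne_top ENNReal.ofReal_ne_top (hab r hr hrρ).2)).1 (hab r hr hrρ).1
  -- Radii beyond `ρ` are handled by shrinking the ball for the lower bound, and by total mass one,
  -- which is at most `(r / ρ) ^ d`, for the upper bound.
  refine ⟨c.toReal * a * min 1 (ρ / R) ^ d, c.toReal * b + 1 / ρ ^ d, by positivity, by positivity,
    fun r hr hrR => ?_, fun r hr => ?_⟩
  · rw [mul_assoc, ← mul_pow]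
    have h1 : min 1 (ρ / R) * r ≤ ρ := by
      calc min 1 (ρ / R) * r ≤ ρ / R * R := by gcongr; exact min_le_right _ _
        _ = ρ := by field_simp
    have h2 : min 1 (ρ / R) * r ≤ r := by
      have := mul_le_mul_of_nonneg_right (min_le_left 1 (ρ / R)) hr.le
      linarith
    exact (hlow _ (by positivity) h1).trans (measureReal_mono (Metric.closedBall_subset_closedBall h2))
  · rcases le_or_gt r ρ with h | h
    · have h1 : τ.real (Metric.closedBall x r) ≤ c.toReal * (b * r ^ d) := by
        rw [hτ]
        exact mul_le_mul_of_nonneg_left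
          (ENNReal.toReal_le_of_le_ofReal (by positivity) (hab r hr h).2) hcp.le
      have : 0 ≤ 1 / ρ ^ d * r ^ d := by positivity
      linarith
    · have h1 : τ.real (Metric.closedBall x r) ≤ 1 := measureReal_le_one
      have h2 : ρ ^ d ≤ r ^ d := by gcongr
      have h3 : 1 ≤ 1 / ρ ^ d * r ^ d := by
        rw [one_div_mul_eq_div, one_le_div (by positivity)]
        exact h2
      have : 0 ≤ c.toReal * b * r ^ d := by positivity
      linarith

end Volume

/-! ### Potentials comparable to a power of the distance -/

section Potential

/-- A function on a compact space that is comparable to a power of the distance to `x` near `x`,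
and positive away from `x`, is globally comparable to it. -/
theorem exists_global_comparison {Θ : Type*} [MetricSpace Θ] [CompactSpace Θ] {Φ : Θ → ℝ}
    (hΦ : Continuous Φ) (x : Θ) (hpos : ∀ θ, θ ≠ x → 0 < Φ θ) (m : ℕ) {a b : ℝ} (ha : 0 < a)
    (hab : ∀ᶠ θ in 𝓝 x, a * dist θ x ^ m ≤ Φ θ ∧ Φ θ ≤ b * dist θ x ^ m) :
    ∃ a b : ℝ, 0 < a ∧ 0 < b ∧ ∀ θ, a * dist θ x ^ m ≤ Φ θ ∧ Φ θ ≤ b * dist θ x ^ m := by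
  obtain ⟨ε, hε, hball⟩ := Metric.eventually_nhds_iff.1 hab
  have hK : IsCompact {θ | ε ≤ dist θ x} :=
    (isClosed_le continuous_const (continuous_id.dist continuous_const)).isCompact
  have hcont : ContinuousOn (fun θ => Φ θ / dist θ x ^ m) {θ | ε ≤ dist θ x} := by
    refine hΦ.continuousOn.div (by fun_prop) fun θ hθ => ?_
    have : 0 < dist θ x := hε.trans_le hθ
    positivity
  obtain ⟨B, hB⟩ := (hK.image_of_continuousOn hcont).bddAbove
  have hlow : ∃ A > 0, ∀ θ, ε ≤ dist θ x → A ≤ Φ θ / dist θ x ^ m := by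
    rcases {θ | ε ≤ dist θ x}.eq_empty_or_nonempty with h | h
    · exact ⟨1, one_pos, fun θ hθ => absurd (show θ ∈ {θ | ε ≤ dist θ x} from hθ) (by simp [h])⟩
    · obtain ⟨θ₀, hθ₀, hmin⟩ := hK.exists_isMinOn h hcont
      refine ⟨_, ?_, fun θ hθ => hmin hθ⟩
      have h0 : 0 < dist θ₀ x := hε.trans_le hθ₀
      have := hpos θ₀ (dist_pos.1 h0)
      positivity
  obtain ⟨A, hA, hlow⟩ := hlow
  refine ⟨min a A, max 1 (max b B), by positivity, by positivity, fun θ => ?_⟩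
  rcases lt_or_ge (dist θ x) ε with h | h
  · obtain ⟨h1, h2⟩ := hball h
    constructor
    · refine le_trans ?_ h1
      gcongr
      exact min_le_left _ _
    · refine h2.trans ?_
      gcongr
      exact (le_max_left _ _).trans (le_max_right _ _)
  · have h0 : 0 < dist θ x ^ m := by have := hε.trans_le h; positivity
    constructor
    · rw [← le_div_iff₀ h0]
      exact (min_le_right _ _).trans (hlow θ h)
    · rw [← div_le_iff₀ h0]
      exact (hB ⟨θ, h, rfl⟩).trans ((le_max_right _ _).trans (le_max_right _ _))

/-- A smooth real function on a manifold has Lipschitz gradient. -/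
theorem ContMDiff.hasLipschitzGradient {d : ℕ} {Θ : Type*} [TopologicalSpace Θ]
    [ChartedSpace (EuclideanSpace ℝ (Fin d)) Θ] [IsManifold (𝓡 d) ∞ Θ] {Φ : Θ → ℝ}
    (hΦ : ContMDiff (𝓡 d) 𝓘(ℝ, ℝ) ∞ Φ) : HasLipschitzGradient (d := d) Φ := by
  refine ⟨hΦ.of_le (by exact_mod_cast le_top), fun x => ?_⟩
  have h1 : ContMDiffOn 𝓘(ℝ, EuclideanSpace ℝ (Fin d)) 𝓘(ℝ, ℝ) ∞
      (Φ ∘ (extChartAt (𝓡 d) x).symm) (extChartAt (𝓡 d) x).target :=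
    hΦ.comp_contMDiffOn (contMDiffOn_extChartAt_symm x)
  have h2 : ContDiffAt ℝ ∞ (Φ ∘ (extChartAt (𝓡 d) x).symm) (extChartAt (𝓡 d) x x) :=
    (contMDiffOn_iff_contDiffOn.1 h1).contDiffAt (extChartAt_target_mem_nhds x)
  have h3 : ContDiffAt ℝ 1 (fderiv ℝ (Φ ∘ (extChartAt (𝓡 d) x).symm)) (extChartAt (𝓡 d) x x) :=
    h2.fderiv_right (m := 1) (by
      rw [one_add_one_eq_two]
      exact WithTop.coe_le_coe.2 le_top)
  exact h3.exists_lipschitzOnWith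

variable {d : ℕ} {Θ : Type*} [MetricSpace Θ] [CompactSpace Θ]
  [ChartedSpace (EuclideanSpace ℝ (Fin d)) Θ] [IsManifold (𝓡 d) ∞ Θ]
  [RiemannianBundle (fun x : Θ => TangentSpace (𝓡 d) x)]
  [IsContinuousRiemannianBundle (EuclideanSpace ℝ (Fin d))
    (fun x : Θ => TangentSpace (𝓡 d) x)]
  [IsRiemannianManifold (𝓡 d) Θ]

variable (d) in
/-- There is a smooth function comparable to the squared distance to a given point. -/
theorem exists_smooth_comparable_sq_dist (x : Θ) :
    ∃ Φ : Θ → ℝ, ContMDiff (𝓡 d) 𝓘(ℝ, ℝ) ∞ Φ ∧ ∃ a b : ℝ, 0 < a ∧ 0 < b ∧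
      ∀ θ, a * dist θ x ^ 2 ≤ Φ θ ∧ Φ θ ≤ b * dist θ x ^ 2 := by
  let f : SmoothBumpFunction (𝓡 d) x := Classical.arbitrary _
  let φ := extChartAt (𝓡 d) x
  -- This is the interpolation `(1 - f) + f * ‖φ θ - φ x‖ ^ 2`: the squared chart distance where the
  -- bump equals 1, the constant 1 off its support, and positive away from `x`.
  let Φ : Θ → ℝ := fun θ => 1 - f θ • (1 - ‖φ θ - φ x‖ ^ 2)
  have hsmooth : ContMDiff (𝓡 d) 𝓘(ℝ, ℝ) ∞ Φ := by
    refine contMDiff_const.sub (f.contMDiff_smul ?_)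
    have h1 : ContMDiffOn (𝓡 d) 𝓘(ℝ, EuclideanSpace ℝ (Fin d)) ∞ φ
        (chartAt (EuclideanSpace ℝ (Fin d)) x).source := contMDiffOn_extChartAt
    have h2 : ContDiff ℝ ∞ fun y : EuclideanSpace ℝ (Fin d) => 1 - ‖y - φ x‖ ^ 2 :=
      contDiff_const.sub ((contDiff_id.sub contDiff_const).norm_sq ℝ)
    exact h2.contMDiff.comp_contMDiffOn h1
  refine ⟨Φ, hsmooth, ?_⟩
  obtain ⟨C₁, V, hV, hVs, hC₁⟩ := exists_lipschitzOnWith_extChartAt (𝓡 d) x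
  obtain ⟨C₂, r₂, hr₂, hsub, hC₂⟩ := exists_lipschitzOnWith_extChartAt_symm (𝓡 d) x
  simp only [modelWithCornersSelf_coe, range_id, inter_univ] at hsub hC₂
  have hxV : x ∈ V := mem_of_mem_nhds hV
  refine exists_global_comparison hsmooth.continuous x (fun θ hθ => ?_) 2
    (a := 1 / (C₂ + 1) ^ 2) (b := C₁ ^ 2) (by positivity) ?_
  · have hf := f.mem_Icc (x := θ)
    by_cases hs : θ ∈ φ.source
    · have h1 : 0 < ‖φ θ - φ x‖ ^ 2 := by
        have : φ θ ≠ φ x := fun h => hθ (φ.injOn hs (mem_extChartAt_source x) h)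
        have := norm_pos_iff.2 (sub_ne_zero.2 this)
        positivity
      simp only [Φ, smul_eq_mul]
      rcases hf.1.eq_or_lt with h0 | h0
      · rw [← h0]
        norm_num
      · linarith [mul_pos h0 h1, hf.2, mul_one_sub (f θ) (‖φ θ - φ x‖ ^ 2)]
    · have : f θ = 0 := by
        by_contra h
        exact hs (by
          rw [extChartAt_source]
          exact f.support_subset_source h)
      simp [Φ, this]
  · have hb : φ ⁻¹' Metric.ball (φ x) r₂ ∈ 𝓝 x :=
      (continuousAt_extChartAt x).preimage_mem_nhds (Metric.ball_mem_nhds _ hr₂)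
    filter_upwards [hV, hb, f.eventuallyEq_one] with θ hθV hθb hf
    have hΦ : Φ θ = dist (φ θ) (φ x) ^ 2 := by
      simp [Φ, hf, dist_eq_norm]
    have h1 := hC₁.dist_le_mul θ hθV x hxV
    have h2 := hC₂.dist_le_mul (φ θ) hθb (φ x) (Metric.mem_ball_self hr₂)
    rw [φ.left_inv (hVs hθV), φ.left_inv (mem_extChartAt_source x)] at h2
    rw [hΦ]
    constructor
    · rw [one_div_mul_eq_div, div_le_iff₀ (by positivity), ← mul_pow]
      have : dist θ x ≤ dist (φ θ) (φ x) * (C₂ + 1) := by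
        have := dist_nonneg (x := φ θ) (y := φ x)
        linarith
      gcongr
    · rw [← mul_pow]
      gcongr

variable [MeasurableSpace Θ] [BorelSpace Θ]

omit [CompactSpace Θ] in
/-- Volume growth of the sublevel sets of a function comparable to a power of the distance. -/
theorem exists_measure_sublevel_bounds (τ : Measure Θ) [IsProbabilityMeasure τ]
    (hτ : ∃ c : ℝ≥0∞, τ = c • (Measure.hausdorffMeasure (d : ℝ) : Measure Θ)) (x : Θ)
    {Φ : Θ → ℝ} {m : ℕ} (hm : m ≠ 0) {a b M : ℝ} (ha : 0 < a) (hb : 0 < b) (hM : 0 < M)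
    (hab : ∀ θ, a * dist θ x ^ m ≤ Φ θ ∧ Φ θ ≤ b * dist θ x ^ m) :
    ∃ κ K : ℝ, 0 < κ ∧ 0 < K ∧
      (∀ t, 0 < t → t ≤ M → κ * t ^ ((d : ℝ) / m) ≤ τ.real {θ | Φ θ ≤ t}) ∧
      ∀ t, 0 < t → τ.real {θ | Φ θ ≤ t} ≤ K * t ^ ((d : ℝ) / m) := by
  have : IsManifold (𝓡 d) 1 Θ := IsManifold.of_le (n := ∞) (by exact_mod_cast le_top)
  have hroot : ∀ {c t : ℝ}, 0 < c → 0 < t →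
      ((t / c) ^ (1 / (m : ℝ))) ^ d = (1 / c) ^ ((d : ℝ) / m) * t ^ ((d : ℝ) / m) := by
    intro c t hc ht
    rw [← Real.rpow_mul_natCast (by positivity), one_div_mul_eq_div,
      ← Real.mul_rpow (by positivity) ht.le, one_div_mul_eq_div]
  have hroot' : ∀ {s : ℝ}, 0 < s → (s ^ (1 / (m : ℝ))) ^ m = s := fun hs => by
    rw [one_div, Real.rpow_inv_natCast_pow hs.le hm]
  -- The sublevel set at height `t` lies between the balls of radii `(t / b) ^ (1 / m)` and `(t / a)
  -- ^ (1 / m)`; the chosen `R` covers the inner radius for all `t ≤ M`.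
  obtain ⟨κ, K, hκ, hK, hlow, hup⟩ := exists_measure_closedBall_bounds (d := d) τ hτ x
    (R := (M / b) ^ (1 / (m : ℝ))) (by positivity)
  refine ⟨κ * (1 / b) ^ ((d : ℝ) / m), K * (1 / a) ^ ((d : ℝ) / m), by positivity, by positivity,
    fun t ht htM => ?_, fun t ht => ?_⟩
  · rw [mul_assoc, ← hroot hb ht]
    refine (hlow _ (by positivity) (by gcongr)).trans (measureReal_mono fun θ hθ => ?_)
    refine (hab θ).2.trans ?_
    rw [← le_div_iff₀' hb, ← hroot' (s := t / b) (by positivity)]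
    exact pow_le_pow_left₀ dist_nonneg hθ m
  · rw [mul_assoc, ← hroot ha ht]
    refine le_trans (measureReal_mono fun θ hθ => ?_) (hup _ (by positivity))
    rw [Metric.mem_closedBall, ← pow_le_pow_iff_left₀ dist_nonneg (by positivity) hm,
      hroot' (by positivity), le_div_iff₀' ha]
    exact (hab θ).1.trans hθ

end Potential

/-! ### Objectives on probability measures -/

section ProbObjective

variable {Θ : Type*} [MeasurableSpace Θ] {τ : Measure Θ}

theorem withDensityᵥ_nonneg_iff (f : Lp ℝ 1 τ) : 0 ≤ τ.withDensityᵥ f ↔ 0 ≤ᵐ[τ] f := by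
  have hf := L1.integrable_coeFn f
  constructor
  · intro h
    refine ae_nonneg_of_forall_setIntegral_nonneg hf fun s hs _ => ?_
    have := h s hs
    rwa [withDensityᵥ_apply hf hs] at this
  · intro h s hs
    rw [withDensityᵥ_apply hf hs]
    exact setIntegral_nonneg_of_ae h

theorem withDensityᵥ_univ (f : Lp ℝ 1 τ) : τ.withDensityᵥ f univ = ∫ θ, f θ ∂τ := by
  rw [withDensityᵥ_apply (L1.integrable_coeFn f) MeasurableSet.univ, setIntegral_univ]

/-- The integral against a nonnegative density. -/
theorem integral_withDensityᵥ {f : Lp ℝ 1 τ} (hf : 0 ≤ᵐ[τ] f) (Φ : Θ → ℝ) :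
    ∫ᵛ θ, Φ θ ∂<•(τ.withDensityᵥ f) = ∫ θ, Φ θ * f θ ∂τ := by
  have hint := L1.integrable_coeFn f
  have : IsFiniteMeasure (τ.withDensity fun θ => ENNReal.ofReal (f θ)) :=
    isFiniteMeasure_withDensity_ofReal hint.2
  have h : τ.withDensityᵥ f = (τ.withDensity fun θ => ENNReal.ofReal (f θ)).toSignedMeasure := by
    ext s hs
    rw [withDensityᵥ_apply hint hs, Measure.toSignedMeasure_apply_measurable hs, measureReal_def,
      withDensity_apply _ hs, integral_eq_lintegral_of_nonneg_ae (ae_restrict_of_ae hf)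
      hint.aestronglyMeasurable.restrict]
  rw [h, VectorMeasure.integral_toSignedMeasure, integral_withDensity_eq_integral_toReal_smul₀
    hint.aestronglyMeasurable.aemeasurable.ennreal_ofReal (ae_of_all _ fun _ => by simp)]
  refine integral_congr_ae (hf.mono fun θ hθ => ?_)
  simp only [smul_eq_mul, ENNReal.toReal_ofReal hθ, mul_comm]

theorem bregman_powerEntropy_two (a b : ℝ) : bregman (powerEntropy 2) a b = (a - b) ^ 2 / 2 := by
  have h : powerEntropy 2 = fun s => s ^ 2 / 2 := by
    ext s
    norm_num [powerEntropy]
  have hd : deriv (fun s : ℝ => s ^ 2 / 2) b = b := by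
    simp
  rw [bregman, h, hd]
  ring

/-- A convex differentiable loss on the real line, vanishing at zero, nonnegative and nondecreasing
on the nonnegative half-line. -/
structure IsLoss (R R' : ℝ → ℝ) : Prop where
  convex : ConvexOn ℝ univ R
  hasDerivAt : ∀ x, HasDerivAt R (R' x) x
  lipschitz : ∃ L : ℝ≥0, LipschitzWith L R'
  zero : R 0 = 0
  nonneg : ∀ x, 0 ≤ x → 0 ≤ R x
  deriv_nonneg : ∀ x, 0 ≤ x → 0 ≤ R' x

theorem IsLoss.gradient_eq {R R' : ℝ → ℝ} (hR : IsLoss R R') : gradient R = R' :=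
  funext fun x => (hR.hasDerivAt x).hasGradientAt'.gradient

theorem isLoss_id : IsLoss (fun x => x) fun _ => 1 where
  convex := convexOn_id convex_univ
  hasDerivAt := hasDerivAt_id
  lipschitz := ⟨0, LipschitzWith.const 1⟩
  zero := rfl
  nonneg _ h := h
  deriv_nonneg _ _ := zero_le_one

theorem isLoss_sq : IsLoss (fun x => x ^ 2 / 2) fun x => x where
  convex := by
    have h : ConvexOn ℝ univ fun x : ℝ => x ^ 2 := even_two.convexOn_pow
    have := h.smul (show (0 : ℝ) ≤ 1 / 2 by norm_num)
    refine this.congr fun x _ => ?_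
    simp only [smul_eq_mul]
    ring
  hasDerivAt x := by
    have := (hasDerivAt_pow 2 x).div_const 2
    simpa using this
  lipschitz := ⟨1, LipschitzWith.id⟩
  zero := by norm_num
  nonneg x _ := by positivity
  deriv_nonneg _ h := h

variable [TopologicalSpace Θ]

/-- The objective `μ ↦ R (∫ Φ dμ)` on probability measures. -/
noncomputable def probObjective (Φ : C(Θ, ℝ)) {R R' : ℝ → ℝ} (hR : IsLoss R R') : Objective Θ where
  E := ℝ
  Φ := Φ
  R := R
  R_convex := hR.convex
  R_differentiable x := (hR.hasDerivAt x).differentiableAt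
  R_smooth := by
    rw [hR.gradient_eq]
    exact hR.lipschitz
  lam := 0
  reg := [.prob]

variable (Φ : C(Θ, ℝ)) {R R' : ℝ → ℝ} (hR : IsLoss R R')

theorem probObjective_G {f : Lp ℝ 1 τ} (hf : 0 ≤ᵐ[τ] f) :
    (probObjective Φ hR).G τ f = R (∫ θ, Φ θ * f θ ∂τ) :=
  congrArg R (integral_withDensityᵥ hf Φ)

theorem probObjective_Gbar' (μ : SignedMeasure Θ) (θ : Θ) :
    (probObjective Φ hR).Gbar' μ θ = R' (∫ᵛ θ, Φ θ ∂<•μ) * Φ θ := by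
  have : (probObjective Φ hR).Gbar' μ θ = ⟪gradient R (∫ᵛ θ, Φ θ ∂<•μ), Φ θ⟫ := rfl
  rw [this, hR.gradient_eq]
  simp [mul_comm]

theorem probObjective_G' {f : Lp ℝ 1 τ} (hf : 0 ≤ᵐ[τ] f) (θ : Θ) :
    (probObjective Φ hR).G' τ f θ = R' (∫ θ, Φ θ * f θ ∂τ) * Φ θ := by
  rw [Objective.G', probObjective_Gbar', integral_withDensityᵥ hf]

open scoped Classical in
theorem probObjective_Hbar (μ : SignedMeasure Θ) :
    (probObjective Φ hR).Hbar μ = if 0 ≤ μ ∧ μ univ = 1 then 0 else ⊤ := by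
  simp [Objective.Hbar, probObjective, RegTerm.val]

open scoped Classical in
theorem probObjective_H (f : Lp ℝ 1 τ) :
    (probObjective Φ hR).H τ f = if 0 ≤ᵐ[τ] f ∧ ∫ θ, f θ ∂τ = 1 then 0 else ⊤ := by
  rw [Objective.H, probObjective_Hbar, withDensityᵥ_nonneg_iff, withDensityᵥ_univ]

theorem probObjective_F {f : Lp ℝ 1 τ} (hf : 0 ≤ᵐ[τ] f) (h1 : ∫ θ, f θ ∂τ = 1) :
    (probObjective Φ hR).F τ f = (R (∫ θ, Φ θ * f θ ∂τ) : ℝ) := by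
  have h : (probObjective Φ hR).F τ f =
    ((probObjective Φ hR).G τ f : EReal) + ((probObjective Φ hR).H τ f : EReal) := rfl
  rw [h, probObjective_G Φ hR hf, probObjective_H, if_pos ⟨hf, h1⟩]
  simp

/-- Since the regularizer is nonnegative, the final lower bound needs only the sign of `f_k`; its
mass need not be tracked. -/
theorem le_probObjective_F {f : Lp ℝ 1 τ} (hf : 0 ≤ᵐ[τ] f) :
    (R (∫ θ, Φ θ * f θ ∂τ) : ℝ) ≤ (probObjective Φ hR).F τ f := by
  have h : (probObjective Φ hR).F τ f =
    ((probObjective Φ hR).G τ f : EReal) + ((probObjective Φ hR).H τ f : EReal) := rfl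
  rw [h, probObjective_G Φ hR hf]
  exact le_add_of_nonneg_right (EReal.coe_ennreal_nonneg _)

theorem probObjective_F_of_not {f : Lp ℝ 1 τ} (h : ¬(0 ≤ᵐ[τ] f ∧ ∫ θ, f θ ∂τ = 1)) :
    (probObjective Φ hR).F τ f = ⊤ := by
  have h' : (probObjective Φ hR).F τ f =
    ((probObjective Φ hR).G τ f : EReal) + ((probObjective Φ hR).H τ f : EReal) := rfl
  rw [h', probObjective_H, if_neg h]
  simp

variable {Φ} {M : ℝ}

/-- The model on which a step of the method is based, at an admissible point. -/
theorem apgmModel_eq [IsProbabilityMeasure τ] (hΦ : IsPotential Φ M) {s γ : ℝ} (hsγ : 0 ≤ γ / s)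
    {g h u : Lp ℝ 1 τ} (hg : 0 ≤ᵐ[τ] g) (hu : 0 ≤ᵐ[τ] u) (hu1 : ∫ θ, u θ ∂τ = 1)
    (huh : Integrable (fun θ => (u θ - h θ) ^ 2) τ) :
    apgmModel (probObjective Φ hR) τ (powerEntropy 2) s γ g h u =
      ((R (∫ θ, Φ θ * g θ ∂τ) + R' (∫ θ, Φ θ * g θ ∂τ) *
        (∫ θ, Φ θ * u θ ∂τ - ∫ θ, Φ θ * g θ ∂τ) +
        γ / s * ((∫ θ, (u θ - h θ) ^ 2 ∂τ) / 2) : ℝ) : EReal) := by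
  have e1 : ∫ θ, (probObjective Φ hR).G' τ g θ * (u θ - g θ) ∂τ = R' (∫ θ, Φ θ * g θ ∂τ) *
        (∫ θ, Φ θ * u θ ∂τ - ∫ θ, Φ θ * g θ ∂τ) := by
    rw [← integral_sub (hΦ.integrable_mul (L1.integrable_coeFn u))
      (hΦ.integrable_mul (L1.integrable_coeFn g)), ← integral_const_mul]
    refine integral_congr_ae (ae_of_all _ fun θ => ?_)
    simp only [probObjective_G' Φ hR hg]
    ring
  have e2 : bregmanInt τ (powerEntropy 2) u h =
      ENNReal.ofReal ((∫ θ, (u θ - h θ) ^ 2 ∂τ) / 2) := by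
    rw [← integral_div, ofReal_integral_eq_lintegral_ofReal (huh.div_const 2)
      (ae_of_all _ fun θ => by positivity)]
    simp only [bregmanInt, bregman_powerEntropy_two]
  rw [apgmModel, e1, e2, probObjective_H, if_pos ⟨hu, hu1⟩, probObjective_G Φ hR hg,
    ← ENNReal.ofReal_mul hsγ, EReal.coe_ennreal_zero, add_zero, EReal.coe_ennreal_ofReal,
    max_eq_left (by
      have : 0 ≤ ∫ θ, (u θ - h θ) ^ 2 ∂τ := integral_nonneg fun θ => sq_nonneg _
      positivity), ← EReal.coe_add]

/-- Points where the model is finite. -/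
theorem of_apgmModel_ne_top {s γ : ℝ} (hsγ : 0 < γ / s) {g h u : Lp ℝ 1 τ}
    (hne : apgmModel (probObjective Φ hR) τ (powerEntropy 2) s γ g h u ≠ ⊤) :
    0 ≤ᵐ[τ] u ∧ ∫ θ, u θ ∂τ = 1 ∧ Integrable (fun θ => (u θ - h θ) ^ 2) τ := by
  by_cases hH : 0 ≤ᵐ[τ] u ∧ ∫ θ, u θ ∂τ = 1
  · refine ⟨hH.1, hH.2, ?_⟩
    rw [apgmModel, probObjective_H, if_pos hH, EReal.coe_ennreal_zero, add_zero] at hne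
    have hfin : bregmanInt τ (powerEntropy 2) u h ≠ ⊤ := by
      intro htop
      rw [htop, ENNReal.mul_top (by simpa using hsγ), EReal.coe_ennreal_top,
        EReal.coe_add_top] at hne
      exact hne rfl
    have hm : AEStronglyMeasurable (fun θ => (u θ - h θ) ^ 2 / 2) τ :=
      (((((L1.integrable_coeFn u).sub (L1.integrable_coeFn h)).aestronglyMeasurable.pow 2).mul_const
        (1 / 2)).congr (ae_of_all _ fun θ => by simp [div_eq_mul_inv]))
    have hi : Integrable (fun θ => (u θ - h θ) ^ 2 / 2) τ := by
      refine ⟨hm, (hasFiniteIntegral_iff_ofReal (ae_of_all _ fun θ => by positivity)).2 ?_⟩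
      simp only [bregmanInt, bregman_powerEntropy_two] at hfin
      exact hfin.lt_top
    refine (hi.mul_const 2).congr (ae_of_all _ fun θ => ?_)
    simp
  · exfalso
    rw [apgmModel, probObjective_H, if_neg hH, EReal.coe_ennreal_top, EReal.coe_add_top,
      EReal.top_add_of_ne_bot] at hne
    · exact hne rfl
    · exact ne_of_gt (lt_of_lt_of_le EReal.bot_lt_zero (EReal.coe_ennreal_nonneg _))

end ProbObjective

/-! ### One step of the method -/

namespace IsPotential

section Prox

variable {Θ : Type*} [MeasurableSpace Θ] {τ : Measure Θ} [IsProbabilityMeasure τ] {Φ : Θ → ℝ}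
  {M : ℝ} (hΦ : IsPotential Φ M)
include hΦ

/-- Strong convexity inequality for the proximal step between two profiles. -/
theorem prox_inequality {a a' : ℝ} (ha : 0 ≤ a) (haa : a ≤ a') {u h h' : Θ → ℝ}
    (hh : h =ᵐ[τ] profile τ Φ a) (hh' : h' =ᵐ[τ] profile τ Φ a')
    (hu : Integrable u τ) (hu0 : 0 ≤ᵐ[τ] u) (hu1 : ∫ θ, u θ ∂τ = 1)
    (huh : Integrable (fun θ => (u θ - h θ) ^ 2) τ) :
    Integrable (fun θ => (u θ - h' θ) ^ 2) τ ∧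
    (a' - a) * ∫ θ, Φ θ * h' θ ∂τ + (∫ θ, (h' θ - h θ) ^ 2 ∂τ) / 2 +
      (∫ θ, (u θ - h' θ) ^ 2 ∂τ) / 2 ≤
    (a' - a) * ∫ θ, Φ θ * u θ ∂τ + (∫ θ, (u θ - h θ) ^ 2 ∂τ) / 2 := by
  have hhi : Integrable h τ := (hΦ.integrable_profile τ a).congr hh.symm
  have hhi' : Integrable h' τ := (hΦ.integrable_profile τ a').congr hh'.symm
  -- Profiles are bounded, which makes the cross terms integrable although `u` is only in `L¹`.
  have hbd : ∀ᵐ θ ∂τ, ‖h' θ - h θ‖ ≤ level τ Φ a' + level τ Φ a := by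
    filter_upwards [hh, hh'] with θ h1 h2
    rw [h1, h2]
    refine (norm_sub_le _ _).trans ?_
    rw [Real.norm_of_nonneg (profile_nonneg _ _), Real.norm_of_nonneg (profile_nonneg _ _)]
    exact add_le_add (hΦ.profile_le_level τ (ha.trans haa) θ) (hΦ.profile_le_level τ ha θ)
  have i1 : Integrable (fun θ => (h' θ - h θ) * (u θ - h' θ)) τ :=
    (hu.sub hhi').bdd_mul (hhi'.sub hhi).aestronglyMeasurable hbd
  have i2 : Integrable (fun θ => (h' θ - h θ) ^ 2) τ := by
    have := (hhi'.sub hhi).bdd_mul (hhi'.sub hhi).aestronglyMeasurable hbd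
    exact this.congr (ae_of_all _ fun θ => (sq (h' θ - h θ)).symm)
  have i3 : Integrable (fun θ => (u θ - h' θ) ^ 2) τ := by
    refine ((huh.sub (i1.const_mul 2)).sub i2).congr (ae_of_all _ fun θ => ?_)
    simp only [Pi.sub_apply]
    ring
  refine ⟨i3, ?_⟩
  have i4 : Integrable (fun θ => Φ θ * u θ - Φ θ * h' θ) τ :=
    (hΦ.integrable_mul hu).sub (hΦ.integrable_mul hhi')
  have i5 : Integrable (fun θ => (h' θ - h θ) ^ 2 + (u θ - h' θ) ^ 2) τ := i2.add i3
  -- The change of level is the Lagrange multiplier of the mass constraint; it disappears because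
  -- `u` and `h'` both have mass one.
  have e1 : ∫ θ, (level τ Φ a' - level τ Φ a) * (u θ - h' θ) ∂τ = 0 := by
    rw [integral_const_mul, integral_sub hu hhi', hu1, integral_congr_ae hh',
      (hΦ.level_spec τ (ha.trans haa)).2, sub_self, mul_zero]
  have e2 : ∫ θ, (level τ Φ a' - level τ Φ a) * (u θ - h' θ) ∂τ ≤
      ∫ θ, ((a' - a) * (Φ θ * u θ - Φ θ * h' θ) + (h' θ - h θ) * (u θ - h' θ)) ∂τ := by
    refine integral_mono_ae ((hu.sub hhi').const_mul _) ((i4.const_mul _).add i1) ?_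
    filter_upwards [hh, hh', hu0] with θ h1 h2 h3
    have := hΦ.optimality τ ha haa h3 θ
    rw [← h1, ← h2] at this
    linarith
  have e3 : ∫ θ, ((a' - a) * (Φ θ * u θ - Φ θ * h' θ) + (h' θ - h θ) * (u θ - h' θ)) ∂τ =
      (a' - a) * (∫ θ, Φ θ * u θ ∂τ - ∫ θ, Φ θ * h' θ ∂τ) +
        ∫ θ, (h' θ - h θ) * (u θ - h' θ) ∂τ := by
    rw [integral_add (i4.const_mul _) i1, integral_const_mul,
      integral_sub (hΦ.integrable_mul hu) (hΦ.integrable_mul hhi')]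
  have e4 : ∫ θ, (u θ - h θ) ^ 2 ∂τ = ∫ θ, (h' θ - h θ) ^ 2 ∂τ + ∫ θ, (u θ - h' θ) ^ 2 ∂τ +
      2 * ∫ θ, (h' θ - h θ) * (u θ - h' θ) ∂τ := by
    rw [← integral_const_mul, ← integral_add i2 i3, ← integral_add i5 (i1.const_mul 2)]
    refine integral_congr_ae (ae_of_all _ fun θ => ?_)
    ring
  rw [e4]
  linarith

variable (τ) in
/-- The profiles as elements of `L¹`. -/
noncomputable def profileL1 (a : ℝ) : Lp ℝ 1 τ :=
  (hΦ.integrable_profile τ a).toL1 _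

variable (τ) in
theorem coeFn_profileL1 (a : ℝ) : hΦ.profileL1 τ a =ᵐ[τ] profile τ Φ a :=
  Integrable.coeFn_toL1 _

theorem profileL1_nonneg (a : ℝ) : 0 ≤ᵐ[τ] hΦ.profileL1 τ a := by
  filter_upwards [hΦ.coeFn_profileL1 τ a] with θ h
  rw [h]
  exact profile_nonneg _ _

theorem integral_profileL1 {a : ℝ} (ha : 0 ≤ a) : ∫ θ, hΦ.profileL1 τ a θ ∂τ = 1 := by
  rw [integral_congr_ae (hΦ.coeFn_profileL1 τ a), (hΦ.level_spec τ ha).2]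

theorem integral_mul_profileL1 (a : ℝ) :
    ∫ θ, Φ θ * hΦ.profileL1 τ a θ ∂τ = profileValue τ Φ a :=
  integral_congr_ae ((hΦ.coeFn_profileL1 τ a).mono fun θ h => by simp only [h])

variable (τ) in
theorem profileL1_zero : hΦ.profileL1 τ 0 = Lp.const 1 τ 1 := by
  refine Lp.ext ?_
  filter_upwards [hΦ.coeFn_profileL1 τ 0, Lp.coeFn_const (p := 1) (μ := τ) (1 : ℝ)] with θ h1 h2
  rw [h1, h2, hΦ.profile_zero τ]
  rfl

omit [IsProbabilityMeasure τ] in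
theorem integral_mul_combination (p q : ℝ) (f h : Lp ℝ 1 τ) :
    ∫ θ, Φ θ * (p • f + q • h : Lp ℝ 1 τ) θ ∂τ =
      p * ∫ θ, Φ θ * f θ ∂τ + q * ∫ θ, Φ θ * h θ ∂τ := by
  rw [← integral_const_mul, ← integral_const_mul, ← integral_add
    ((hΦ.integrable_mul (L1.integrable_coeFn f)).const_mul p)
    ((hΦ.integrable_mul (L1.integrable_coeFn h)).const_mul q)]
  refine integral_congr_ae ?_
  filter_upwards [Lp.coeFn_add (p • f) (q • h), Lp.coeFn_smul p f, Lp.coeFn_smul q h]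
    with θ h1 h2 h3
  simp only [h1, Pi.add_apply, h2, h3, Pi.smul_apply, smul_eq_mul]
  ring

end Prox

theorem _root_.combination_nonneg {Θ : Type*} [MeasurableSpace Θ] {τ : Measure Θ} {p q : ℝ}
    (hp : 0 ≤ p) (hq : 0 ≤ q) {f h : Lp ℝ 1 τ} (hf : 0 ≤ᵐ[τ] f) (hh : 0 ≤ᵐ[τ] h) :
    0 ≤ᵐ[τ] (p • f + q • h : Lp ℝ 1 τ) := by
  filter_upwards [Lp.coeFn_add (p • f) (q • h), Lp.coeFn_smul p f, Lp.coeFn_smul q h, hf, hh]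
    with θ h1 h2 h3 h4 h5
  simp only [h1, Pi.add_apply, h2, h3, Pi.smul_apply, smul_eq_mul]
  exact add_nonneg (mul_nonneg hp h4) (mul_nonneg hq h5)

variable {Θ : Type*} [TopologicalSpace Θ] [MeasurableSpace Θ] {τ : Measure Θ}
  [IsProbabilityMeasure τ] {Φ : C(Θ, ℝ)} {M : ℝ} (hΦ : IsPotential Φ M) {R R' : ℝ → ℝ}
  (hR : IsLoss R R')
include hΦ

/-- The minimizer of the model of a step started from a profile is a profile. -/
theorem isMinOn_apgmModel_iff {s γ a : ℝ} (hs : 0 < s) (hγ : 0 < γ) (ha : 0 ≤ a)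
    {g u : Lp ℝ 1 τ} (hg : 0 ≤ᵐ[τ] g) :
    IsMinOn (apgmModel (probObjective Φ hR) τ (powerEntropy 2) s γ g (hΦ.profileL1 τ a)) univ u ↔
      u = hΦ.profileL1 τ (a + s * R' (∫ θ, Φ θ * g θ ∂τ) / γ) := by
  have hsγ : 0 < γ / s := by positivity
  set x := ∫ θ, Φ θ * g θ ∂τ with hx
  have hx0 : 0 ≤ x := integral_nonneg_of_ae (hg.mono fun θ h => mul_nonneg (hΦ.nonneg θ) h)
  have hb := hR.deriv_nonneg x hx0
  set a' := a + s * R' x / γ with ha'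
  have haa : a ≤ a' := by
    have : 0 ≤ s * R' x / γ := by positivity
    linarith
  -- With this substitution the model is, up to a constant, `γ / s` times the functional in
  -- `prox_inequality`. Its quadratic remainder gives both minimality and uniqueness.
  have hRa : R' x = γ / s * (a' - a) := by
    rw [ha']
    field_simp
    ring
  set h := hΦ.profileL1 τ a with hh
  set h' := hΦ.profileL1 τ a' with hh'
  have key : ∀ u : Lp ℝ 1 τ, 0 ≤ᵐ[τ] u → ∫ θ, u θ ∂τ = 1 →
      Integrable (fun θ => (u θ - h θ) ^ 2) τ → _ := fun u h0 h1 h2 =>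
    hΦ.prox_inequality ha haa (hΦ.coeFn_profileL1 τ a) (hΦ.coeFn_profileL1 τ a')
      (L1.integrable_coeFn u) h0 h1 h2
  have hint : Integrable (fun θ => (h' θ - h θ) ^ 2) τ := by
    have e : ∀ᵐ θ ∂τ, (h' θ - h θ) ^ 2 = (profile τ Φ a' θ - profile τ Φ a θ) ^ 2 := by
      filter_upwards [hΦ.coeFn_profileL1 τ a, hΦ.coeFn_profileL1 τ a'] with θ h1 h2
      rw [h1, h2]
    refine Integrable.of_bound (((L1.integrable_coeFn h').sub
      (L1.integrable_coeFn h)).aestronglyMeasurable.pow 2)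
      ((level τ Φ a' + level τ Φ a) ^ 2) (e.mono fun θ h1 => ?_)
    rw [h1, Real.norm_of_nonneg (sq_nonneg _)]
    have p1 := profile_nonneg (τ := τ) (Φ := Φ) a θ
    have p2 := profile_nonneg (τ := τ) (Φ := Φ) a' θ
    have p3 := hΦ.profile_le_level τ ha θ
    have p4 := hΦ.profile_le_level τ (ha.trans haa) θ
    exact sq_le_sq' (by linarith) (by linarith)
  have hmodel' := apgmModel_eq hR hΦ hsγ.le hg (hΦ.profileL1_nonneg a')
    (hΦ.integral_profileL1 (ha.trans haa)) hint
  constructor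
  · intro hmin
    have hle := hmin (mem_univ h')
    simp only [mem_ofPred_eq] at hle
    rw [hmodel'] at hle
    obtain ⟨u0, u1, u2⟩ := of_apgmModel_ne_top hR hsγ
      (ne_top_of_le_ne_top (EReal.coe_ne_top _) hle)
    rw [apgmModel_eq hR hΦ hsγ.le hg u0 u1 u2, EReal.coe_le_coe_iff, ← hx, hRa] at hle
    obtain ⟨k1, k2⟩ := key u u0 u1 u2
    have k3 := mul_le_mul_of_nonneg_left k2 hsγ.le
    have k4 : γ / s * (∫ θ, (u θ - h' θ) ^ 2 ∂τ) ≤ 0 := by linarith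
    have k5 : ∫ θ, (u θ - h' θ) ^ 2 ∂τ = 0 :=
      le_antisymm (nonpos_of_mul_nonpos_right k4 hsγ) (integral_nonneg fun θ => sq_nonneg _)
    rw [integral_eq_zero_iff_of_nonneg (fun θ => sq_nonneg _) k1] at k5
    refine Lp.ext (k5.mono fun θ hθ => ?_)
    have : (u θ - h' θ) ^ 2 = 0 := hθ
    exact sub_eq_zero.1 (pow_eq_zero_iff two_ne_zero |>.1 this)
  · rintro rfl u -
    simp only [mem_ofPred_eq]
    by_cases htop : apgmModel (probObjective Φ hR) τ (powerEntropy 2) s γ g h u = ⊤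
    · rw [htop]
      exact le_top
    obtain ⟨u0, u1, u2⟩ := of_apgmModel_ne_top hR hsγ htop
    obtain ⟨k1, k2⟩ := key u u0 u1 u2
    rw [hmodel', apgmModel_eq hR hΦ hsγ.le hg u0 u1 u2, EReal.coe_le_coe_iff, ← hx, hRa]
    have k3 := mul_le_mul_of_nonneg_left k2 hsγ.le
    have k4 : 0 ≤ γ / s * ∫ θ, (u θ - h' θ) ^ 2 ∂τ :=
      mul_nonneg hsγ.le (integral_nonneg fun θ => sq_nonneg _)
    linarith

end IsPotential

/-! ### The iterates -/

namespace IsPotential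

variable {Θ : Type*} [TopologicalSpace Θ] [MeasurableSpace Θ] {τ : Measure Θ}
  [IsProbabilityMeasure τ] {Φ : C(Θ, ℝ)} {M : ℝ} (hΦ : IsPotential Φ M) {R R' : ℝ → ℝ}
  (hR : IsLoss R R')
include hΦ

/-- The values of the iterates follow the scalar dynamics. -/
theorem isScalarAPGM_of_isAPGM {s : ℝ} (hs : 0 < s) {f g h : ℕ → Lp ℝ 1 τ} {γ : ℕ → ℝ}
    (H : IsAPGM (probObjective Φ hR) τ (powerEntropy 2) s (Lp.const 1 τ 1) f g h γ) :
    (∀ k, 0 ≤ᵐ[τ] f k) ∧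
      ∃ A : ℕ → ℝ, IsScalarAPGM R' s (profileValue τ Φ) γ (fun k => ∫ θ, Φ θ * f k θ ∂τ) A := by
  have hγ : IsExtrapolation γ := ⟨H.γ_zero, H.γ_succ⟩
  let A : ℕ → ℝ := fun k => ∑ j ∈ Finset.range k, s * R' (∫ θ, Φ θ * g j θ ∂τ) / γ j
  have hA : ∀ k, A (k + 1) = A k + s * R' (∫ θ, Φ θ * g k θ ∂τ) / γ k := fun k =>
    Finset.sum_range_succ _ k
  have hg : ∀ k, 0 ≤ᵐ[τ] f k → h k = hΦ.profileL1 τ (A k) → 0 ≤ᵐ[τ] g k := by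
    intro k h1 h2
    rw [H.g_eq, h2]
    exact combination_nonneg (by linarith [(hγ.pos_le_one k).2]) (hγ.pos_le_one k).1.le h1
      (hΦ.profileL1_nonneg _)
  have key : ∀ k, 0 ≤ᵐ[τ] f k ∧ h k = hΦ.profileL1 τ (A k) ∧ 0 ≤ A k := by
    intro k
    induction k with
    | zero =>
      have h0 : A 0 = 0 := Finset.sum_range_zero _
      rw [H.f_zero, H.h_zero, h0, ← hΦ.profileL1_zero τ]
      exact ⟨hΦ.profileL1_nonneg 0, rfl, le_rfl⟩
    | succ k ih =>
      obtain ⟨h1, h2, h3⟩ := ih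
      have h4 := hg k h1 h2
      have hmin := H.h_succ k
      rw [h2, hΦ.isMinOn_apgmModel_iff hR hs (hγ.pos_le_one k).1 h3 h4, ← hA] at hmin
      refine ⟨?_, hmin, ?_⟩
      · rw [H.f_succ, hmin]
        exact combination_nonneg (by linarith [(hγ.pos_le_one k).2]) (hγ.pos_le_one k).1.le h1
          (hΦ.profileL1_nonneg _)
      · rw [hA]
        have := hR.deriv_nonneg _ (integral_nonneg_of_ae
          (h4.mono fun θ h => mul_nonneg (hΦ.nonneg θ) h))
        have := (hγ.pos_le_one k).1
        positivity
  refine ⟨fun k => (key k).1, A, hγ, Finset.sum_range_zero _, fun k => ?_, fun k => ?_⟩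
  · rw [hA, H.g_eq, hΦ.integral_mul_combination, (key k).2.1, hΦ.integral_mul_profileL1]
  · rw [H.f_succ, hΦ.integral_mul_combination, (key (k + 1)).2.1, hΦ.integral_mul_profileL1]

/-- Iterates exist for every step-size. -/
theorem exists_isAPGM {s : ℝ} (hs : 0 < s) :
    ∃ (f g h : ℕ → Lp ℝ 1 τ) (γ : ℕ → ℝ),
      IsAPGM (probObjective Φ hR) τ (powerEntropy 2) s (Lp.const 1 τ 1) f g h γ := by
  -- The state is the triple `(f_k, A_k, γ_k)`: `h_k` is recovered as the profile at `A_k`, and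
  -- `g_k` as `G` of the state.
  let G : Lp ℝ 1 τ × ℝ × ℝ → Lp ℝ 1 τ := fun p =>
    (1 - p.2.2) • p.1 + p.2.2 • hΦ.profileL1 τ p.2.1
  let a' : Lp ℝ 1 τ × ℝ × ℝ → ℝ := fun p => p.2.1 + s * R' (∫ θ, Φ θ * G p θ ∂τ) / p.2.2
  let step : Lp ℝ 1 τ × ℝ × ℝ → Lp ℝ 1 τ × ℝ × ℝ := fun p =>
    ((1 - p.2.2) • p.1 + p.2.2 • hΦ.profileL1 τ (a' p), a' p,
      (√(p.2.2 ^ 4 + 4 * p.2.2 ^ 2) - p.2.2 ^ 2) / 2)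
  let S : ℕ → Lp ℝ 1 τ × ℝ × ℝ := fun k => step^[k] (Lp.const 1 τ 1, 0, 1)
  have hS : ∀ k, S (k + 1) = step (S k) := fun k => Function.iterate_succ_apply' _ _ _
  have hγ : IsExtrapolation fun k => (S k).2.2 := ⟨rfl, fun k => by rw [hS]⟩
  have hGnn : ∀ k, 0 ≤ᵐ[τ] (S k).1 → 0 ≤ᵐ[τ] G (S k) := fun k h1 =>
    combination_nonneg (by linarith [(hγ.pos_le_one k).2]) (hγ.pos_le_one k).1.le h1
      (hΦ.profileL1_nonneg _)
  have key : ∀ k, 0 ≤ᵐ[τ] (S k).1 ∧ 0 ≤ (S k).2.1 := by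
    intro k
    have hk := hγ.pos_le_one k
    induction k with
    | zero =>
      refine ⟨?_, le_rfl⟩
      change 0 ≤ᵐ[τ] (Lp.const 1 τ 1 : Lp ℝ 1 τ)
      rw [← hΦ.profileL1_zero τ]
      exact hΦ.profileL1_nonneg 0
    | succ k ih =>
      have hk := hγ.pos_le_one k
      obtain ⟨h1, h2⟩ := ih hk
      rw [hS]
      refine ⟨combination_nonneg (by linarith [hk.2]) hk.1.le h1 (hΦ.profileL1_nonneg _), ?_⟩
      have h3 := hR.deriv_nonneg _ (integral_nonneg_of_ae
          ((hGnn k h1).mono fun θ h => mul_nonneg (hΦ.nonneg θ) h))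
      exact add_nonneg h2 (div_nonneg (mul_nonneg hs.le h3) hk.1.le)
  refine ⟨fun k => (S k).1, fun k => G (S k), fun k => hΦ.profileL1 τ (S k).2.1,
    fun k => (S k).2.2, ?_, rfl, hΦ.profileL1_zero τ, rfl, fun k => rfl, fun k => ?_, fun k => ?_,
    hγ.succ⟩
  · rw [← hΦ.profileL1_zero τ, probObjective_H,
      if_pos ⟨hΦ.profileL1_nonneg 0, hΦ.integral_profileL1 le_rfl⟩]
    exact ENNReal.zero_ne_top
  · rw [hΦ.isMinOn_apgmModel_iff hR hs (hγ.pos_le_one k).1 (key k).2 (hGnn k (key k).1), hS]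
  · rw [hS]

/-- The infimum of the objective, when the profiles concentrate on the zeros of the potential. -/
theorem infF_probObjective
    (hlim : Filter.Tendsto (profileValue τ Φ) Filter.atTop (𝓝 0)) :
    (probObjective Φ hR).infF τ = 0 := by
  refine le_antisymm ?_ (le_iInf fun f => ?_)
  -- The infimum ranges over densities only, so the value zero is approached along the profiles as
  -- `a → ∞`.
  · have h1 : Filter.Tendsto (fun a => ((R (profileValue τ Φ a) : ℝ) : EReal)) Filter.atTop
        (𝓝 ((R 0 : ℝ) : EReal)) :=
      (continuous_coe_real_ereal.tendsto _).comp
        (((hR.hasDerivAt 0).continuousAt.tendsto).comp hlim)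
    rw [hR.zero, EReal.coe_zero] at h1
    refine ge_of_tendsto h1 ((Filter.eventually_ge_atTop 0).mono fun a ha => ?_)
    refine (iInf_le _ (hΦ.profileL1 τ a)).trans (le_of_eq ?_)
    rw [probObjective_F Φ hR (hΦ.profileL1_nonneg a) (hΦ.integral_profileL1 ha),
      hΦ.integral_mul_profileL1]
  · by_cases h : 0 ≤ᵐ[τ] f ∧ ∫ θ, f θ ∂τ = 1
    · rw [probObjective_F Φ hR h.1 h.2, ← EReal.coe_zero, EReal.coe_le_coe_iff]
      exact hR.nonneg _ (integral_nonneg_of_ae (h.1.mono fun θ h => mul_nonneg (hΦ.nonneg θ) h))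
    · rw [probObjective_F_of_not Φ hR h]
      exact le_top

/-- Existence of the iterates and lower bound on their values, given a lower bound for the scalar
dynamics. -/
theorem exists_lower_bound
    (hlim : Filter.Tendsto (profileValue τ Φ) Filter.atTop (𝓝 0)) {p : ℝ}
    (hscalar : ∀ s : ℝ, 0 < s → ∃ c : ℝ, 0 < c ∧ ∀ γ y A : ℕ → ℝ,
      IsScalarAPGM R' s (profileValue τ Φ) γ y A → 0 ≤ y 0 →
        ∀ k : ℕ, 1 ≤ k → c * (k : ℝ) ^ (-p) ≤ R (y k)) (s : ℝ) (hs : 0 < s) :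
    (∃ (f g h : ℕ → Lp ℝ 1 τ) (γ : ℕ → ℝ),
      IsAPGM (probObjective Φ hR) τ (powerEntropy 2) s (Lp.const 1 τ 1) f g h γ) ∧
    ∃ c : ℝ, 0 < c ∧ ∀ (f g h : ℕ → Lp ℝ 1 τ) (γ : ℕ → ℝ),
      IsAPGM (probObjective Φ hR) τ (powerEntropy 2) s (Lp.const 1 τ 1) f g h γ →
      ∀ k : ℕ, 1 ≤ k → ((c * (k : ℝ) ^ (-p) : ℝ) : EReal) ≤
        (probObjective Φ hR).F τ (f k) - (probObjective Φ hR).infF τ := by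
  refine ⟨hΦ.exists_isAPGM hR hs, ?_⟩
  obtain ⟨c, hc, hbound⟩ := hscalar s hs
  refine ⟨c, hc, fun f g h γ H k hk => ?_⟩
  obtain ⟨hf, A, hA⟩ := hΦ.isScalarAPGM_of_isAPGM hR hs H
  rw [hΦ.infF_probObjective hR hlim, sub_zero]
  refine le_trans ?_ (le_probObjective_F Φ hR (hf k))
  exact EReal.coe_le_coe_iff.2 (hbound γ _ A hA
    (integral_nonneg_of_ae ((hf 0).mono fun θ h => mul_nonneg (hΦ.nonneg θ) h)) k hk)

end IsPotential

/-! ### Minimizing measures -/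

section Dirac

variable {Θ : Type*} [MetricSpace Θ] [MeasurableSpace Θ] [BorelSpace Θ]
  (Φ : C(Θ, ℝ)) {R R' : ℝ → ℝ} (hR : IsLoss R R') {x : Θ}

theorem integral_dirac_toSignedMeasure :
    ∫ᵛ θ, Φ θ ∂<•(Measure.dirac x).toSignedMeasure = Φ x := by
  rw [VectorMeasure.integral_toSignedMeasure, integral_dirac]

theorem probObjective_Fbar_dirac (hx : Φ x = 0) :
    (probObjective Φ hR).Fbar (Measure.dirac x).toSignedMeasure = 0 := by
  have h : (probObjective Φ hR).Gbar (Measure.dirac x).toSignedMeasure = 0 := by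
    have : (probObjective Φ hR).Gbar (Measure.dirac x).toSignedMeasure =
      R (∫ᵛ θ, Φ θ ∂<•(Measure.dirac x).toSignedMeasure) := rfl
    rw [this, integral_dirac_toSignedMeasure, hx, hR.zero]
  rw [Objective.Fbar, h, probObjective_Hbar, if_pos]
  · simp
  · refine ⟨Measure.zero_le_toSignedMeasure _, ?_⟩
    rw [Measure.toSignedMeasure_apply_measurable MeasurableSet.univ, probReal_univ]

theorem probObjective_Gbar'_dirac (hx : Φ x = 0) (hR' : R' 0 = 0) (θ : Θ) :
    (probObjective Φ hR).Gbar' (Measure.dirac x).toSignedMeasure θ = 0 := by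
  rw [probObjective_Gbar', integral_dirac_toSignedMeasure, hx, hR', zero_mul]

end Dirac

/-! ### Potentials with polynomial volume growth -/

section Growth

variable {d : ℕ} {Θ : Type*} [MetricSpace Θ] [CompactSpace Θ] [MeasurableSpace Θ] [BorelSpace Θ]
  [ChartedSpace (EuclideanSpace ℝ (Fin d)) Θ] [IsManifold (𝓡 d) ∞ Θ]
  [RiemannianBundle (fun x : Θ => TangentSpace (𝓡 d) x)]
  [IsContinuousRiemannianBundle (EuclideanSpace ℝ (Fin d))
    (fun x : Θ => TangentSpace (𝓡 d) x)]
  [IsRiemannianManifold (𝓡 d) Θ]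

/-- Lower bounds for the linear and the quadratic loss, for a potential comparable to a power of
the distance to a point. -/
theorem exists_lower_bound_of_comparable_dist (hd : 1 ≤ d) (τ : Measure Θ)
    [IsProbabilityMeasure τ]
    (hτ : ∃ c : ℝ≥0∞, τ = c • (Measure.hausdorffMeasure (d : ℝ) : Measure Θ)) (x : Θ)
    (Φ : C(Θ, ℝ)) {m : ℕ} (hm : m ≠ 0) {a b : ℝ} (ha : 0 < a) (hb : 0 < b)
    (hab : ∀ θ, a * dist θ x ^ m ≤ Φ θ ∧ Φ θ ≤ b * dist θ x ^ m) :
    ∃ M : ℝ, IsPotential Φ M ∧ Filter.Tendsto (profileValue τ Φ) Filter.atTop (𝓝 0) ∧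
      (∀ s : ℝ, 0 < s → ∃ c : ℝ, 0 < c ∧ ∀ γ y A : ℕ → ℝ,
        IsScalarAPGM (fun _ => 1) s (profileValue τ Φ) γ y A → 0 ≤ y 0 →
          ∀ k : ℕ, 1 ≤ k → c * (k : ℝ) ^ (-(2 * (m : ℝ) / (d + m))) ≤ y k) ∧
      ∀ s : ℝ, 0 < s → ∃ c : ℝ, 0 < c ∧ ∀ γ y A : ℕ → ℝ,
        IsScalarAPGM (fun x => x) s (profileValue τ Φ) γ y A → 0 ≤ y 0 →
          ∀ k : ℕ, 1 ≤ k → c * (k : ℝ) ^ (-(2 * (2 * m : ℝ) / (d + 2 * m))) ≤ y k ^ 2 / 2 := by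
  obtain ⟨B, hB⟩ := (isCompact_range Φ.continuous).bddAbove
  have hΦ : IsPotential Φ (max 1 B) :=
    ⟨Φ.continuous.measurable, fun θ => le_trans (by positivity) (hab θ).1,
      fun θ => (hB ⟨θ, rfl⟩).trans (le_max_right _ _)⟩
  obtain ⟨κ, K, hκ, hK, hlow, hup⟩ := exists_measure_sublevel_bounds (d := d) τ hτ x (Φ := Φ) hm
    (M := max 1 B) ha hb (by positivity) hab
  have hd0 : (0 : ℝ) < d := by exact_mod_cast hd
  have hm0 : (0 : ℝ) < m := by exact_mod_cast Nat.pos_of_ne_zero hm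
  obtain ⟨κ', K', hκ', hK', hbounds⟩ := hΦ.exists_profileValue_bounds (τ := τ)
    (α := (d : ℝ) / m) (by positivity) hκ hK (le_max_left _ _) hlow hup
  have hβ : 1 / (1 + (d : ℝ) / m) = m / (d + m) := by
    field_simp
    ring
  rw [hβ] at hbounds
  set β : ℝ := m / (d + m) with hβdef
  have hβ0 : 0 < β := by positivity
  have hβ1 : β < 1 := by
    rw [hβdef, div_lt_one (by positivity)]
    linarith
  refine ⟨max 1 B, hΦ, ?_, fun s hs => ?_, fun s hs => ?_⟩
  · have h1 : Filter.Tendsto (fun a : ℝ => K' * (1 + a) ^ (-β)) Filter.atTop (𝓝 (K' * 0)) :=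
      (((tendsto_rpow_neg_atTop hβ0).comp
        (Filter.tendsto_atTop_add_const_left _ 1 Filter.tendsto_id)).const_mul K')
    rw [mul_zero] at h1
    refine tendsto_of_tendsto_of_tendsto_of_le_of_le' tendsto_const_nhds h1
      (Filter.Eventually.of_forall fun a => hΦ.profileValue_nonneg a)
      ((Filter.eventually_ge_atTop 0).mono fun a ha => (hbounds a ha).2)
  · obtain ⟨c, hc, h⟩ := exists_lower_bound_linear hs hκ' hβ0 fun a ha => (hbounds a ha).1
    refine ⟨c, hc, fun γ y A H _ k hk => ?_⟩
    have := h γ y A H k hk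
    rwa [hβdef, ← mul_div_assoc] at this
  · obtain ⟨c, hc, h⟩ := exists_lower_bound_quadratic hs hκ' hK' hβ0 hβ1
      (fun a ha => (hbounds a ha).1) fun a ha => (hbounds a ha).2
    refine ⟨c ^ 2 / 2, by positivity, fun γ y A H h0 k hk => ?_⟩
    have h1 := pow_le_pow_left₀ (by positivity) (h γ y A H h0 k hk) 2
    -- Squaring the scalar rate gives the exponent `4 * β / (1 + β) = 4 * m / (d + 2 * m)`: the
    -- quadratic loss doubles `q` from `m` to `2 * m`.
    have e : ((k : ℝ) ^ (-(2 * β / (1 + β)))) ^ 2 =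
        (k : ℝ) ^ (-(2 * (2 * m : ℝ) / (d + 2 * m))) := by
      rw [← Real.rpow_mul_natCast (by positivity)]
      congr 1
      rw [hβdef]
      push_cast
      field_simp
      ring
    rw [mul_pow, e] at h1
    linarith

end Growth

theorem mainTheorem4 {d : ℕ} (hd : 1 ≤ d)
    {Θ : Type*} [MetricSpace Θ] [CompactSpace Θ] [MeasurableSpace Θ] [BorelSpace Θ]
    [ChartedSpace (EuclideanSpace ℝ (Fin d)) Θ] [IsManifold (𝓡 d) ∞ Θ]
    [RiemannianBundle (fun x : Θ => TangentSpace (𝓡 d) x)]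
    [IsContMDiffRiemannianBundle (𝓡 d) ∞ (EuclideanSpace ℝ (Fin d))
      (fun x : Θ => TangentSpace (𝓡 d) x)]
    [IsRiemannianManifold (𝓡 d) Θ]
    (τ : Measure Θ) [IsProbabilityMeasure τ]
    (hτ : ∃ c : ℝ≥0∞, τ = c • (Measure.hausdorffMeasure (d : ℝ) : Measure Θ))
    (S : Setting) :
    ∃ J : Objective Θ, S.Holds (d := d) τ J ∧
      ∀ s : ℝ, 0 < s →
        (∃ (f g h : ℕ → Lp ℝ 1 τ) (γ : ℕ → ℝ),
          IsAPGM J τ (powerEntropy 2) s (Lp.const 1 τ 1) f g h γ) ∧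
        ∃ c : ℝ, 0 < c ∧
          ∀ (f g h : ℕ → Lp ℝ 1 τ) (γ : ℕ → ℝ),
            IsAPGM J τ (powerEntropy 2) s (Lp.const 1 τ 1) f g h γ →
            ∀ k : ℕ, 1 ≤ k →
              ((c * (k : ℝ) ^ (-(2 * S.q / (d + S.q) : ℝ)) : ℝ) : EReal)
                ≤ J.F τ (f k) - J.infF τ := by
  have : IsContinuousRiemannianBundle (EuclideanSpace ℝ (Fin d))
      (fun x : Θ => TangentSpace (𝓡 d) x) := by
    obtain ⟨g, hg, h⟩ := IsContMDiffRiemannianBundle.exists_contMDiff (IB := 𝓡 d) (n := ∞)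
      (F := EuclideanSpace ℝ (Fin d)) (E := fun x : Θ => TangentSpace (𝓡 d) x)
    exact ⟨g, hg.continuous, h⟩
  obtain ⟨x⟩ : Nonempty Θ := τ.nonempty_of_neZero
  -- The distance serves the Lipschitz settings; it is not smooth at `x`, so the settings with
  -- Lipschitz gradient use the smooth substitute `Φ₂` for its square.
  let Φ₁ : C(Θ, ℝ) := ⟨fun θ => dist θ x, by fun_prop⟩
  have hΦ₁x : Φ₁ x = 0 := dist_self x
  have hΦ₁ : LipschitzWith 1 Φ₁ := LipschitzWith.dist_left x
  obtain ⟨M₁, hM₁, hlim₁, hlin₁, hquad₁⟩ := exists_lower_bound_of_comparable_dist hd τ hτ x Φ₁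
    (m := 1) one_ne_zero one_pos one_pos (fun θ => by simp [Φ₁])
  obtain ⟨Φ, hsmooth, a, b, ha, hb, hab⟩ := exists_smooth_comparable_sq_dist d x
  let Φ₂ : C(Θ, ℝ) := ⟨Φ, hsmooth.continuous⟩
  have hΦ₂x : Φ₂ x = 0 := by
    have := hab x
    simp only [dist_self, ne_eq, OfNat.ofNat_ne_zero, not_false_eq_true, zero_pow, mul_zero] at this
    exact le_antisymm this.2 this.1
  have hΦ₂ : HasLipschitzGradient (d := d) Φ₂ := hsmooth.hasLipschitzGradient
  obtain ⟨M₂, hM₂, hlim₂, hlin₂, hquad₂⟩ := exists_lower_bound_of_comparable_dist hd τ hτ x Φ₂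
    (m := 2) two_ne_zero ha hb hab
  cases S with
  | I =>
    refine ⟨probObjective Φ₁ isLoss_id, ⟨⟨1, hΦ₁⟩, (Measure.dirac x).toSignedMeasure, ?_⟩, ?_⟩
    · rw [probObjective_Fbar_dirac Φ₁ isLoss_id hΦ₁x, hM₁.infF_probObjective isLoss_id hlim₁]
    · simpa only [Setting.q] using hM₁.exists_lower_bound isLoss_id hlim₁ hlin₁
  | II =>
    refine ⟨probObjective Φ₂ isLoss_id, ⟨hΦ₂, (Measure.dirac x).toSignedMeasure, ?_⟩, ?_⟩
    · rw [probObjective_Fbar_dirac Φ₂ isLoss_id hΦ₂x, hM₂.infF_probObjective isLoss_id hlim₂]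
    · simpa only [Setting.q] using hM₂.exists_lower_bound isLoss_id hlim₂ hlin₂
  | IStar =>
    refine ⟨probObjective Φ₁ isLoss_sq, ⟨⟨1, hΦ₁⟩, (Measure.dirac x).toSignedMeasure, ?_, ?_⟩, ?_⟩
    · rw [probObjective_Fbar_dirac Φ₁ isLoss_sq hΦ₁x, hM₁.infF_probObjective isLoss_sq hlim₁]
    · exact probObjective_Gbar'_dirac Φ₁ isLoss_sq hΦ₁x rfl
    · have e : ((Setting.q .IStar : ℕ) : ℝ) = 2 * ((1 : ℕ) : ℝ) := by norm_num [Setting.q]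
      rw [e]
      exact hM₁.exists_lower_bound isLoss_sq hlim₁ hquad₁
  | IIStar =>
    refine ⟨probObjective Φ₂ isLoss_sq, ⟨hΦ₂, (Measure.dirac x).toSignedMeasure, ?_, ?_⟩, ?_⟩
    · rw [probObjective_Fbar_dirac Φ₂ isLoss_sq hΦ₂x, hM₂.infF_probObjective isLoss_sq hlim₂]
    · exact probObjective_Gbar'_dirac Φ₂ isLoss_sq hΦ₂x rfl
    · have e : ((Setting.q .IIStar : ℕ) : ℝ) = 2 * ((2 : ℕ) : ℝ) := by norm_num [Setting.q]
      rw [e]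
      exact hM₂.exists_lower_bound isLoss_sq hlim₂ hquad₂
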